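/- \textbf{Setup.} Let $\hbar$ be a formal variable, $\mathcal{C}=\mathbb{Q}[\hbar]$, and let $\mathfrak{H}=\mathcal{C}\langle x,y,\rho\rangle$ be the non-commutative polynomial algebra. Put $\xi=y-\rho$, $z_k=x^{k-1}y$ $(k\ge 1)$, and $A=\{\xi\}\cup\{z_k\}_{k\ge1}$. Let $\mathfrak{H}^1\subset\mathfrak{H}$ be the subalgebra generated by $A$ (it is freely generated by $A$), and $$\widehat{\mathfrak{H}}^0=\mathcal{C}+\xi\mathfrak{H}^1+\sum_{k\ge2}z_k\mathfrak{H}^1 .$$ The harmonic product $*$ on $\mathfrak{H}^1$ is the $\mathcal{C}$-bilinear product with $1*w=w*1=w$ and $$(u_1w)*(u_2w')=u_1(w*u_2w')+u_2(u_1w*w')+(u_1\circ u_2)(w*w')\qquad(u_1,u_2\in A),$$ where $z_k\circ z_l=z_{k+l}+\hbar z_{k+l-1}$, $\xi\circ z_k=z_k\circ\xi=z_{k+1}$, $\xi\circ\xi=z_2-\hbar\xi$. The integral shuffle product ш on $\mathfrak{H}$ is the $\mathcal{C}$-bilinear product with $1\,ш\,w=w\,ш\,1=w$ and $$uw\,ш\,vw'=u(w\,ш\,vw')+v(uw\,ш\,w')+\alpha(u,v)(w\,ш\,w')\qquad(u,v\in\{x,y,\rho\}),$$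 where $\alpha(x,x)=\hbar x$, $\alpha(x,y)=\alpha(y,x)=0$, $\alpha(y,y)=-y\rho$, $\alpha(u,\rho)=\alpha(\rho,u)=-u\rho$ for $u\in\{x,y,\rho\}$. Give $x,y,\rho,\hbar$ weight $1$ and let $\widehat{\mathfrak{H}}^0_d$ be the ($\mathbb{Q}$-linear) component of $\widehat{\mathfrak{H}}^0$ of weight $d$. Let $q\in\mathbb{C}$ with $0<|q|<1$, let $\hbar$ act on $\mathbb{C}$ as $1-q$, and put $[n]=(1-q^n)/(1-q)$, $I_\xi(n)=q^n/[n]$, $I_{z_k}(n)=q^{(k-1)n}/[n]^k$. Let $Z_q:\widehat{\mathfrak{H}}^0\to\mathbb{C}$ be the $\mathcal{C}$-linear map with $Z_q(1)=1$ and $$Z_q(u_1\cdots u_r)=\sum_{n_1>\cdots>n_r>0}\ \prod_{i=1}^rI_{u_i}(n_i)\qquad(u_i\in A,\ u_1\ne z_1),$$ and let $\bar Z_q:\widehat{\mathfrak{H}}^0\to\mathbb{C}$ be the $\mathbb{Q}$-linear map with $\bar Z_q(w)=(1-q)^{-d}Z_q(w)$ for $w\in\widehat{\mathfrak{H}}^0_d$.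 For an admissible index $\mathbf{k}=(k_1,\dots,k_r)$ (positive integers, $k_1\ge2$ if $r\ge1$; the empty index is allowed) put $|\mathbf{k}|=\sum k_i$, $z_{\mathbf{k}}=z_{k_1}\cdots z_{k_r}$ and $$\bar\zeta_q(\mathbf{k})=(1-q)^{-|\mathbf{k}|}\sum_{n_1>\cdots>n_r>0}\ \prod_{i=1}^r\frac{q^{(k_i-1)n_i}}{[n_i]^{k_i}} .$$ \textbf{Theorem.} The series defining $Z_q$ converge absolutely. For $d\ge0$ let $S_d$ be the $\mathbb{Q}$-span of all elements $w*w'-w\,ш\,w'$, where $w\in\widehat{\mathfrak{H}}^0_m$, $w'\in\widehat{\mathfrak{H}}^0_n$ and $m+n=d$. Then $S_d$ is a subspace of $\widehat{\mathfrak{H}}^0_d$ and $$S_d\subset\ker\bar Z_q .$$ Consequently the double shuffle relations hold: whenever a finite $\mathbb{Q}$-linear combination $\sum_{|\mathbf{k}|\le d}c_{\mathbf{k}}\,\hbar^{d-|\mathbf{k}|}z_{\mathbf{k}}$ over admissible indices lies in $S_d$, one has $\sum_{|\mathbf{k}|\le d}c_{\mathbf{k}}\,\bar\zeta_q(\mathbf{k})=0$.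 -/

import Mathlib

namespace QMZV

noncomputable section

/-- The coefficient ring `ℚ[ħ]`. -/
abbrev Coeff : Type := Polynomial ℚ

/-- The formal variable `ħ`. -/
def hbar : Coeff := Polynomial.X

/-- The letters `x`, `y`, `ρ`. -/
inductive Letter : Type
  | x : Letter
  | y : Letter
  | rho : Letter

/-- The non-commutative polynomial algebra `𝔥 = ℚ[ħ]⟨x, y, ρ⟩`. -/
abbrev H : Type := FreeAlgebra Coeff Letter

/-- The letters of the alphabet `A = {ξ} ∪ {z_k : k ≥ 1}`. -/
inductive ALetter : Type
  | xi : ALetter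
  | z : (k : ℕ) → 1 ≤ k → ALetter

/-- The free algebra over `ℚ[ħ]` on the abstract alphabet `A`. -/
abbrev FA : Type := FreeAlgebra Coeff ALetter

/-! ### Words as a basis of a free algebra -/

/-- The word `u₁ ⋯ u_r` as an element of a free algebra. -/
def word {X : Type} (w : List X) : FreeAlgebra Coeff X :=
  (w.map (FreeAlgebra.ι Coeff)).prod

/-- The words form a basis of the free algebra (see `wordBasis_apply`). -/
def wordBasis (X : Type) : Module.Basis (List X) Coeff (FreeAlgebra Coeff X) :=
  (FreeAlgebra.basisFreeMonoid Coeff X).reindex FreeMonoid.toList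

theorem wordBasis_apply {X : Type} (w : List X) : wordBasis X w = word w := by
  simp only [wordBasis, Module.Basis.reindex_apply, FreeAlgebra.basisFreeMonoid,
    Module.Basis.map_apply]
  simp [FreeAlgebra.equivMonoidAlgebraFreeMonoid, word, FreeMonoid.lift_apply]

theorem word_nil {X : Type} : word ([] : List X) = 1 := by simp [word]

theorem word_cons {X : Type} (u : X) (w : List X) :
    word (u :: w) = FreeAlgebra.ι Coeff u * word w := by simp [word]

/-- The `ℚ[ħ]`-bilinear extension of a product that is given on words. -/
def bilinExtend {X : Type} (f : List X → List X → FreeAlgebra Coeff X) :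
    FreeAlgebra Coeff X →ₗ[Coeff] FreeAlgebra Coeff X →ₗ[Coeff] FreeAlgebra Coeff X :=
  (wordBasis X).constr Coeff fun w => (wordBasis X).constr Coeff fun w' => f w w'

theorem bilinExtend_word {X : Type} (f : List X → List X → FreeAlgebra Coeff X)
    (w w' : List X) : bilinExtend f (word w) (word w') = f w w' := by
  simp only [bilinExtend, ← wordBasis_apply, Module.Basis.constr_basis]

/-! ### The subalgebra `𝔥¹` and the submodule `Ĥ⁰` -/

/-- The elements `x`, `y`, `ρ` of `𝔥`. -/
def x : H := FreeAlgebra.ι Coeff Letter.x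
def y : H := FreeAlgebra.ι Coeff Letter.y
def rho : H := FreeAlgebra.ι Coeff Letter.rho

/-- `ξ = y - ρ`. -/
def xi : H := y - rho

/-- `z_k = x^{k-1} y` (used for `k ≥ 1` only). -/
def z (k : ℕ) : H := x ^ (k - 1) * y

/-- The element of `𝔥` named by a letter of `A`. -/
def ALetter.toH : ALetter → H
  | ALetter.xi => QMZV.xi
  | ALetter.z k _ => QMZV.z k

/-- `𝔥¹`, the subalgebra of `𝔥` generated by `A`. -/
def H1 : Subalgebra Coeff H := Algebra.adjoin Coeff (Set.range ALetter.toH)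

/-- `Ĥ⁰ = ℚ[ħ] + ξ 𝔥¹ + ∑_{k ≥ 2} z_k 𝔥¹`. -/
def H0hat : Submodule Coeff H :=
  Submodule.span Coeff {1} ⊔
    (Subalgebra.toSubmodule H1).map (LinearMap.mulLeft Coeff xi) ⊔
    ⨆ (k : ℕ) (_ : 2 ≤ k), (Subalgebra.toSubmodule H1).map (LinearMap.mulLeft Coeff (z k))

theorem toH_mem_H1 (a : ALetter) : a.toH ∈ H1 :=
  Algebra.subset_adjoin ⟨a, rfl⟩

theorem H0hat_le_H1 : H0hat ≤ Subalgebra.toSubmodule H1 := by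
  refine sup_le (sup_le ?_ ?_) (iSup₂_le fun k hk => ?_)
  · rw [Submodule.span_le]
    rintro _ rfl
    exact H1.one_mem
  · rintro _ ⟨w, hw, rfl⟩
    exact H1.mul_mem (toH_mem_H1 ALetter.xi) hw
  · rintro _ ⟨w, hw, rfl⟩
    exact H1.mul_mem (toH_mem_H1 (ALetter.z k (by omega))) hw

/-! ### `𝔥¹` is freely generated by `A` -/

/-- The canonical map from the free algebra on the alphabet `A` to `𝔥`. -/
def enc : FA →ₐ[Coeff] H := FreeAlgebra.lift Coeff ALetter.toH

/-- Auxiliary: rewriting of `x^k w`, `w` a word in `x, y, ρ`, in the letters of `A`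
(using `ρ = z₁ - ξ`); parts outside `𝔥¹` are dropped. -/
def decWord : ℕ → List Letter → FA
  | 0, [] => 1
  | _ + 1, [] => 0
  | k, Letter.x :: v => decWord (k + 1) v
  | k, Letter.y :: v =>
      FreeAlgebra.ι Coeff (ALetter.z (k + 1) (Nat.le_add_left 1 k)) * decWord 0 v
  | 0, Letter.rho :: v =>
      (FreeAlgebra.ι Coeff (ALetter.z 1 le_rfl) - FreeAlgebra.ι Coeff ALetter.xi) * decWord 0 v
  | k + 1, Letter.rho :: v =>
      FreeAlgebra.ι Coeff (ALetter.z (k + 2) (Nat.le_add_left 1 (k + 1))) * decWord 0 v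

/-- Auxiliary: a linear left inverse of `enc`. -/
def dec (k : ℕ) : H →ₗ[Coeff] FA := (wordBasis Letter).constr Coeff (decWord k)

theorem dec_word (k : ℕ) (v : List Letter) : dec k (word v) = decWord k v := by
  simp only [dec, ← wordBasis_apply, Module.Basis.constr_basis]

theorem dec_x_mul (k : ℕ) (h : H) : dec k (x * h) = dec (k + 1) h := by
  have : (dec k).comp (LinearMap.mulLeft Coeff x) = dec (k + 1) := by
    refine (wordBasis Letter).ext fun v => ?_
    rw [wordBasis_apply, LinearMap.comp_apply, LinearMap.mulLeft_apply, x, ← word_cons,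
      dec_word, dec_word]
    cases k <;> simp [decWord]
  exact LinearMap.congr_fun this h

theorem dec_y_mul (k : ℕ) (h : H) : dec k (y * h) =
    FreeAlgebra.ι Coeff (ALetter.z (k + 1) (Nat.le_add_left 1 k)) * dec 0 h := by
  have : (dec k).comp (LinearMap.mulLeft Coeff y) = (LinearMap.mulLeft Coeff
      (FreeAlgebra.ι Coeff (ALetter.z (k + 1) (Nat.le_add_left 1 k)))).comp (dec 0) := by
    refine (wordBasis Letter).ext fun v => ?_
    rw [wordBasis_apply, LinearMap.comp_apply, LinearMap.mulLeft_apply, y, ← word_cons,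
      LinearMap.comp_apply, LinearMap.mulLeft_apply, dec_word, dec_word]
    cases k <;> simp [decWord]
  exact LinearMap.congr_fun this h

theorem dec_rho_mul (h : H) : dec 0 (rho * h) =
    (FreeAlgebra.ι Coeff (ALetter.z 1 le_rfl) - FreeAlgebra.ι Coeff ALetter.xi) * dec 0 h := by
  have : (dec 0).comp (LinearMap.mulLeft Coeff rho) = (LinearMap.mulLeft Coeff
      (FreeAlgebra.ι Coeff (ALetter.z 1 le_rfl) - FreeAlgebra.ι Coeff ALetter.xi)).comp
        (dec 0) := by
    refine (wordBasis Letter).ext fun v => ?_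
    rw [wordBasis_apply, LinearMap.comp_apply, LinearMap.mulLeft_apply, rho, ← word_cons,
      LinearMap.comp_apply, LinearMap.mulLeft_apply, dec_word, dec_word]
    simp [decWord]
  exact LinearMap.congr_fun this h

theorem dec_x_pow_mul (j k : ℕ) (h : H) : dec k (x ^ j * h) = dec (k + j) h := by
  induction j generalizing k with
  | zero => simp
  | succ j ih => rw [pow_succ', mul_assoc, dec_x_mul, ih, Nat.add_right_comm, Nat.add_assoc]

theorem dec_toH_mul (a : ALetter) (h : H) :
    dec 0 (a.toH * h) = FreeAlgebra.ι Coeff a * dec 0 h := by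
  cases a with
  | xi => simp [ALetter.toH, QMZV.xi, sub_mul, dec_y_mul, dec_rho_mul]
  | z k hk =>
    obtain ⟨j, rfl⟩ : ∃ j, k = j + 1 := ⟨k - 1, by omega⟩
    simp [ALetter.toH, QMZV.z, mul_assoc, dec_x_pow_mul, dec_y_mul]

theorem enc_word (u : List ALetter) : enc (word u) = (u.map ALetter.toH).prod := by
  induction u with
  | nil => simp [word_nil]
  | cons a u ih => rw [word_cons, map_mul, ih, enc, FreeAlgebra.lift_ι_apply]; simp

theorem dec_enc (g : FA) : dec 0 (enc g) = g := by
  have : (dec 0).comp enc.toLinearMap = LinearMap.id := by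
    refine (wordBasis ALetter).ext fun u => ?_
    rw [wordBasis_apply, LinearMap.comp_apply, AlgHom.toLinearMap_apply, LinearMap.id_apply]
    induction u with
    | nil =>
      rw [word_nil, map_one, ← word_nil, dec_word, decWord]
    | cons a u ih =>
      rw [word_cons, map_mul, enc, FreeAlgebra.lift_ι_apply, dec_toH_mul]
      rw [enc] at ih
      rw [ih]
  exact LinearMap.congr_fun this g

theorem enc_injective : Function.Injective enc :=
  Function.LeftInverse.injective dec_enc

theorem enc_range : enc.range = H1 :=
  (Algebra.adjoin_range_eq_range_freeAlgebra_lift (R := Coeff) (f := ALetter.toH)).symm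

/-- `𝔥¹` is the free algebra on `A`: the isomorphism sends each letter of `A` to the element
of `𝔥` it names. -/
def freeEquivH1 : FA ≃ₐ[Coeff] H1 :=
  (AlgEquiv.ofInjective enc enc_injective).trans (Subalgebra.equivOfEq _ _ enc_range)

theorem coe_freeEquivH1 (g : FA) : (freeEquivH1 g : H) = enc g := rfl

theorem freeEquivH1_symm_apply (w : H1) : freeEquivH1.symm w = dec 0 (w : H) := by
  obtain ⟨g, rfl⟩ := freeEquivH1.surjective w
  rw [AlgEquiv.symm_apply_apply, coe_freeEquivH1, dec_enc]

/-! ### The two products -/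

/-- The product `∘` on letters of `A`. -/
def circ : ALetter → ALetter → FA
  | ALetter.z k hk, ALetter.z l _ =>
      FreeAlgebra.ι Coeff (ALetter.z (k + l) (by omega)) +
        hbar • FreeAlgebra.ι Coeff (ALetter.z (k + l - 1) (by omega))
  | ALetter.xi, ALetter.z k _ => FreeAlgebra.ι Coeff (ALetter.z (k + 1) (by omega))
  | ALetter.z k _, ALetter.xi => FreeAlgebra.ι Coeff (ALetter.z (k + 1) (by omega))
  | ALetter.xi, ALetter.xi =>
      FreeAlgebra.ι Coeff (ALetter.z 2 (by omega)) - hbar • FreeAlgebra.ι Coeff ALetter.xi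

/-- The harmonic product of two words in `A`. -/
def harmWord : List ALetter → List ALetter → FA
  | [], w' => word w'
  | u :: w, [] => word (u :: w)
  | u :: w, v :: w' =>
      FreeAlgebra.ι Coeff u * harmWord w (v :: w') +
        FreeAlgebra.ι Coeff v * harmWord (u :: w) w' +
        circ u v * harmWord w w'
  termination_by w w' => w.length + w'.length

/-- The harmonic product `w * w'` on `𝔥¹`, the `ℚ[ħ]`-bilinear extension of the product of words,
transported along the identification of `𝔥¹` with the free algebra on `A`. -/
def harm (w w' : H1) : H1 :=
  freeEquivH1 (bilinExtend harmWord (freeEquivH1.symm w) (freeEquivH1.symm w'))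

/-- The correction term `α(u, v)` of the integral shuffle product. -/
def alpha : Letter → Letter → H
  | Letter.x, Letter.x => hbar • x
  | Letter.x, Letter.y => 0
  | Letter.y, Letter.x => 0
  | Letter.y, Letter.y => -(y * rho)
  | u, Letter.rho => -(FreeAlgebra.ι Coeff u * rho)
  | Letter.rho, u => -(FreeAlgebra.ι Coeff u * rho)

/-- The integral shuffle product of two words in `x`, `y`, `ρ`. -/
def shWord : List Letter → List Letter → H
  | [], w' => word w'
  | u :: w, [] => word (u :: w)
  | u :: w, v :: w' =>
      FreeAlgebra.ι Coeff u * shWord w (v :: w') +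
        FreeAlgebra.ι Coeff v * shWord (u :: w) w' +
        alpha u v * shWord w w'
  termination_by w w' => w.length + w'.length

/-- The integral shuffle product on `𝔥`, `ℚ[ħ]`-bilinear. -/
def sh (w w' : H) : H := bilinExtend shWord w w'

/-! ### The weight -/

/-- The elements of `𝔥` homogeneous of weight `d`, where `x, y, ρ, ħ` all have weight one. -/
def weightPart (d : ℕ) : Submodule ℚ H :=
  Submodule.span ℚ {h | ∃ (j : ℕ) (v : List Letter), j + v.length = d ∧ h = hbar ^ j • word v}

/-- `Ĥ⁰_d`, the component of `Ĥ⁰` of weight `d`. -/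
def H0hatPart (d : ℕ) : Submodule ℚ H := H0hat.restrictScalars ℚ ⊓ weightPart d

theorem H0hatPart_le_H1 {d : ℕ} {w : H} (hw : w ∈ H0hatPart d) : w ∈ H1 :=
  H0hat_le_H1 hw.1

/-- The weight of a letter of `A`. -/
def ALetter.weight : ALetter → ℕ
  | ALetter.xi => 1
  | ALetter.z k _ => k

/-- The weight of a word in `A`. -/
def wordWeight (u : List ALetter) : ℕ := (u.map ALetter.weight).sum

/-! ### The maps `Z_q` and `Z̄_q` -/

/-- The `q`-integer `[n]`. -/
def qInt (q : ℂ) (n : ℕ) : ℂ := (1 - q ^ n) / (1 - q)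

/-- `I_u(n)` for a letter `u` of `A`. -/
def I (q : ℂ) : ALetter → ℕ → ℂ
  | ALetter.xi, n => q ^ n / qInt q n
  | ALetter.z k _, n => q ^ ((k - 1) * n) / qInt q n ^ k

/-- The sequences `n₁ > ⋯ > n_r > 0`. -/
def DecSeq (r : ℕ) : Type := {n : Fin r → ℕ // StrictAnti n ∧ ∀ i, 0 < n i}

/-- The summand `∏ I_{u_i}(n_i)` of `Z_q(u₁ ⋯ u_r)`. -/
def ZTerm (q : ℂ) (u : List ALetter) (n : DecSeq u.length) : ℂ :=
  ∏ i : Fin u.length, I q (u.get i) (n.1 i)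

/-- The value `Z_q(u₁ ⋯ u_r)` on a word in `A`; it is `1` on the empty word. -/
def ZWord (q : ℂ) (u : List ALetter) : ℂ := ∑' n : DecSeq u.length, ZTerm q u n

/-- A word in `A` is admissible if it is empty or starts with `ξ` or some `z_k`, `k ≥ 2`; these
words span `Ĥ⁰` over `ℚ[ħ]` (see `H0hat_eq_span`). -/
def AdmissibleWord : List ALetter → Prop
  | [] => True
  | ALetter.xi :: _ => True
  | ALetter.z k _ :: _ => 2 ≤ k

theorem H0hat_eq_span : H0hat =
    Submodule.span Coeff {h | ∃ u, AdmissibleWord u ∧ h = (u.map ALetter.toH).prod} := by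
  have key : ∀ a : ALetter, (∀ u, AdmissibleWord (a :: u)) →
      (Subalgebra.toSubmodule H1).map (LinearMap.mulLeft Coeff a.toH) ≤
      Submodule.span Coeff {h | ∃ u, AdmissibleWord u ∧ h = (u.map ALetter.toH).prod} := by
    rintro a ha _ ⟨w, hw, rfl⟩
    obtain ⟨g, rfl⟩ : ∃ g, enc g = w := by
      rw [← enc_range] at hw; exact hw
    have hg : g ∈ Submodule.span Coeff (Set.range (wordBasis ALetter)) := by
      rw [Module.Basis.span_eq]; trivial
    induction hg using Submodule.span_induction with
    | mem g hg =>
      obtain ⟨u, rfl⟩ := hg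
      refine Submodule.subset_span ⟨a :: u, ha u, ?_⟩
      rw [wordBasis_apply, enc_word, LinearMap.mulLeft_apply, List.map_cons, List.prod_cons]
    | zero => simp
    | add g g' hg hg' h h' =>
      have hm : ∀ g, enc g ∈ Subalgebra.toSubmodule H1 := fun g => by
        rw [← enc_range]; exact ⟨g, rfl⟩
      rw [map_add, map_add]; exact Submodule.add_mem _ (h (hm _)) (h' (hm _))
    | smul c g hg h =>
      have hm : ∀ g, enc g ∈ Subalgebra.toSubmodule H1 := fun g => by
        rw [← enc_range]; exact ⟨g, rfl⟩
      rw [map_smul, map_smul]; exact Submodule.smul_mem _ _ (h (hm _))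
  have hprod : ∀ u : List ALetter, (u.map ALetter.toH).prod ∈ Subalgebra.toSubmodule H1 :=
    fun u => by rw [← enc_word, ← enc_range]; exact ⟨_, rfl⟩
  apply le_antisymm
  · refine sup_le (sup_le ?_ ?_) (iSup₂_le fun k hk => ?_)
    · rw [Submodule.span_le]
      rintro _ rfl
      exact Submodule.subset_span ⟨[], trivial, rfl⟩
    · exact key ALetter.xi fun _ => trivial
    · exact key (ALetter.z k (by omega)) fun _ => hk
  · rw [Submodule.span_le]
    rintro _ ⟨u, hu, rfl⟩
    rcases u with _ | ⟨_ | ⟨k, hk⟩, u⟩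
    · exact Submodule.mem_sup_left (Submodule.mem_sup_left (Submodule.subset_span rfl))
    · exact Submodule.mem_sup_left (Submodule.mem_sup_right ⟨_, hprod u, rfl⟩)
    · refine Submodule.mem_sup_right ?_
      have h2 : 2 ≤ k := hu
      exact Submodule.mem_iSup_of_mem k (Submodule.mem_iSup_of_mem h2 ⟨_, hprod u, rfl⟩)

/-- The action of `ℚ[ħ]` on `ℂ`, in which `ħ` acts as `1 - q`. -/
def evalHbar (q : ℂ) : Coeff →+* ℂ := Polynomial.eval₂RingHom (algebraMap ℚ ℂ) (1 - q)

/-- The coordinates of an element of the free algebra on `A` with respect to words in `A`. -/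
def coords : FA →ₗ[Coeff] (List ALetter →₀ Coeff) := (wordBasis ALetter).repr.toLinearMap

theorem coords_smul_word (c : Coeff) (u : List ALetter) :
    coords (c • word u) = Finsupp.single u c := by
  rw [coords, LinearEquiv.coe_coe, map_smul, ← wordBasis_apply, Module.Basis.repr_self,
    Finsupp.smul_single, smul_eq_mul, mul_one]

/-- An element of `Ĥ⁰` as an element of the free algebra on `A`. -/
def toFree : H0hat →ₗ[Coeff] FA :=
  freeEquivH1.symm.toLinearMap ∘ₗ Submodule.inclusion H0hat_le_H1

theorem toFree_apply (w : H0hat) : toFree w = dec 0 (w : H) :=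
  freeEquivH1_symm_apply ⟨w, H0hat_le_H1 w.2⟩

/-- The `ℚ[ħ]`-linear map (`ħ` acting on `ℂ` as `1 - q`) that sends each word `u` in `A`
to `ZWord q u`; only its values on combinations of admissible words are used. -/
def ZFree (q : ℂ) : FA →ₛₗ[evalHbar q] ℂ where
  toFun g := (coords g).sum fun u c => evalHbar q c * ZWord q u
  map_add' w w' := by
    rw [map_add]
    exact Finsupp.sum_add_index' (by simp) (by intros; rw [map_add, add_mul])
  map_smul' c w := by
    rw [map_smul, Finsupp.sum_smul_index (by simp), smul_eq_mul, Finsupp.sum, Finsupp.sum,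
      Finset.mul_sum]
    simp only [map_mul, mul_assoc]

theorem ZFree_smul_word (q : ℂ) (c : Coeff) (u : List ALetter) :
    ZFree q (c • word u) = evalHbar q c * ZWord q u := by
  change (coords (c • word u)).sum (fun u c => evalHbar q c * ZWord q u) = _
  rw [coords_smul_word, Finsupp.sum_single_index (by simp)]

/-- The map `Z_q : Ĥ⁰ → ℂ`, `ℚ[ħ]`-linear with `ħ` acting on `ℂ` as `1 - q`. -/
def Z (q : ℂ) : H0hat →ₛₗ[evalHbar q] ℂ := (ZFree q).comp toFree

/-- The `ℚ`-linear map with value `(1 - q)^{-(j + wt u)} Z_q(ħ^j u)` on `ħ^j u`, for `j ≥ 0`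
and each word `u` in `A`. -/
def ZbarFree (q : ℂ) : FA →ₗ[ℚ] ℂ :=
  (Finsupp.lsum ℚ fun u : List ALetter =>
    (Polynomial.lsum fun j : ℕ => LinearMap.toSpanSingleton ℚ ℂ
      (((1 - q) ^ (j + wordWeight u))⁻¹ * ZFree q (hbar ^ j • word u)) : Coeff →ₗ[ℚ] ℂ)) ∘ₗ
    coords.restrictScalars ℚ

theorem ZbarFree_hbar_word (q : ℂ) (j : ℕ) (u : List ALetter) :
    ZbarFree q (hbar ^ j • word u) =
      ((1 - q) ^ (j + wordWeight u))⁻¹ * ZFree q (hbar ^ j • word u) := by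
  rw [ZbarFree, LinearMap.comp_apply, LinearMap.restrictScalars_apply, coords_smul_word,
    Finsupp.lsum_single, Polynomial.lsum_apply]
  nth_rewrite 1 [hbar, Polynomial.X_pow_eq_monomial]
  rw [Polynomial.sum_monomial_index _ _ (by simp), LinearMap.toSpanSingleton_apply, one_smul]

/-- The map `Z̄_q : Ĥ⁰ → ℂ`, which is `ℚ`-linear and equal to `(1 - q)^{-d} Z_q` on `Ĥ⁰_d`
for each `d` (see `Zbar_eq`). -/
def Zbar (q : ℂ) : H0hat →ₗ[ℚ] ℂ := ZbarFree q ∘ₗ toFree.restrictScalars ℚ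

theorem decWord_mem (k : ℕ) (v : List Letter) :
    decWord k v ∈ Submodule.span ℚ
      {g : FA | ∃ u : List ALetter, wordWeight u = k + v.length ∧ g = word u} := by
  have key : ∀ (a : ALetter) (m n : ℕ) (g : FA), a.weight + m = n →
      g ∈ Submodule.span ℚ {g : FA | ∃ u : List ALetter, wordWeight u = m ∧ g = word u} →
      FreeAlgebra.ι Coeff a * g ∈
        Submodule.span ℚ {g : FA | ∃ u : List ALetter, wordWeight u = n ∧ g = word u} := by
    intro a m n g hn hg
    induction hg using Submodule.span_induction with
    | mem g h =>
      obtain ⟨u, hu, rfl⟩ := h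
      refine Submodule.subset_span ⟨a :: u, ?_, (word_cons a u).symm⟩
      simp only [wordWeight, List.map_cons, List.sum_cons] at hu ⊢
      omega
    | zero => simp
    | add g g' _ _ h h' => rw [mul_add]; exact Submodule.add_mem _ h h'
    | smul c g _ h => rw [mul_smul_comm]; exact Submodule.smul_mem _ _ h
  induction v generalizing k with
  | nil =>
    cases k with
    | zero => exact Submodule.subset_span ⟨[], rfl, word_nil.symm⟩
    | succ k => simp [decWord]
  | cons a v ih =>
    have h0 := ih 0
    cases a with
    | x =>
      have h1 := ih (k + 1)
      have e : k + 1 + v.length = k + (Letter.x :: v).length := by simp; omega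
      rw [e] at h1
      cases k <;> simpa only [decWord] using h1
    | y =>
      have h1 := key (ALetter.z (k + 1) (Nat.le_add_left 1 k)) _
        (k + (Letter.y :: v).length) _ (by simp [ALetter.weight]; omega) h0
      cases k <;> simpa only [decWord] using h1
    | rho =>
      cases k with
      | zero =>
        simp only [decWord, sub_mul]
        exact Submodule.sub_mem _
          (key _ _ _ _ (by simp [ALetter.weight]; omega) h0)
          (key _ _ _ _ (by simp [ALetter.weight]; omega) h0)
      | succ k =>
        simp only [decWord]
        exact key _ _ _ _ (by simp [ALetter.weight]; omega) h0

theorem dec_mem {d : ℕ} {h : H} (hh : h ∈ weightPart d) : dec 0 h ∈ Submodule.span ℚ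
    {g : FA | ∃ (j : ℕ) (u : List ALetter), j + wordWeight u = d ∧ g = hbar ^ j • word u} := by
  induction hh using Submodule.span_induction with
  | mem h hh =>
    obtain ⟨j, v, hd, rfl⟩ := hh
    rw [map_smul, dec_word]
    have hv := decWord_mem 0 v
    generalize decWord 0 v = g at hv ⊢
    induction hv using Submodule.span_induction with
    | mem g hg =>
      obtain ⟨u, hu, rfl⟩ := hg
      exact Submodule.subset_span ⟨j, u, by omega, rfl⟩
    | zero => simp
    | add g g' _ _ h h' => rw [smul_add]; exact Submodule.add_mem _ h h'
    | smul c g _ h => rw [smul_comm]; exact Submodule.smul_mem _ _ h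
  | zero => simp
  | add g g' _ _ h h' => rw [map_add]; exact Submodule.add_mem _ h h'
  | smul c g _ h =>
    rw [LinearMap.map_smul_of_tower]; exact Submodule.smul_mem _ _ h

/-- `Z̄_q(w) = (1 - q)^{-d} Z_q(w)` for all `w ∈ Ĥ⁰_d`. -/
theorem Zbar_eq (q : ℂ) (d : ℕ) (w : H0hat) (hw : (w : H) ∈ H0hatPart d) :
    Zbar q w = ((1 - q) ^ d)⁻¹ * Z q w := by
  change ZbarFree q (toFree w) = _ * ZFree q (toFree w)
  rw [toFree_apply]
  have hg := dec_mem hw.2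
  generalize dec 0 (w : H) = g at hg ⊢
  induction hg using Submodule.span_induction with
  | mem g hg =>
    obtain ⟨j, u, hd, rfl⟩ := hg
    rw [ZbarFree_hbar_word, hd]
  | zero => simp
  | add g g' _ _ h h' => rw [map_add, map_add, mul_add, h, h']
  | smul c g _ h => rw [map_smul, h, map_rat_smul, mul_smul_comm]

/-- `Z_q(u₁ ⋯ u_r) = ∑_{n₁ > ⋯ > n_r > 0} ∏ I_{u_i}(n_i)` for each word in `Ĥ⁰`. -/
theorem Z_word (q : ℂ) (u : List ALetter) (hu : (u.map ALetter.toH).prod ∈ H0hat) :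
    Z q ⟨(u.map ALetter.toH).prod, hu⟩ = ∑' n : DecSeq u.length, ZTerm q u n := by
  change ZFree q (toFree _) = ZWord q u
  have h : toFree ⟨(u.map ALetter.toH).prod, hu⟩ = word u := by
    rw [toFree_apply]
    change dec 0 (u.map ALetter.toH).prod = _
    rw [← enc_word, dec_enc]
  rw [h, ← one_smul Coeff (word u), ZFree_smul_word, map_one, one_mul]

/-! ### The double shuffle space and the modified `q`-multiple zeta values -/

/-- `S_d`, the `ℚ`-span of the elements `w * w' - w ш w'` with `w, w'` homogeneous elements of `Ĥ⁰`
whose weights sum to `d`. -/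
def S (d : ℕ) : Submodule ℚ H :=
  Submodule.span ℚ {s | ∃ (m n : ℕ) (w w' : H) (hw : w ∈ H0hatPart m) (hw' : w' ∈ H0hatPart n),
    m + n = d ∧
    s = (harm ⟨w, H0hatPart_le_H1 hw⟩ ⟨w', H0hatPart_le_H1 hw'⟩ : H1) - sh w w'}

/-- The kernel of `Z̄_q`, as a `ℚ`-subspace of `𝔥` contained in `Ĥ⁰`. -/
def kerZbar (q : ℂ) : Submodule ℚ H :=
  (LinearMap.ker (Zbar q)).map (H0hat.subtype.restrictScalars ℚ)

/-- Admissible indices: finite sequences of positive integers that are empty or have first entry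
at least two. -/
def AdmissibleIndex : Type :=
  {k : List ℕ // (∀ a ∈ k, 1 ≤ a) ∧ ∀ a ∈ k.head?, 2 ≤ a}

/-- The weight `|k|` of an index. -/
def AdmissibleIndex.weight (k : AdmissibleIndex) : ℕ := k.1.sum

/-- The word `z_{k_1} ⋯ z_{k_r}`. -/
def AdmissibleIndex.zWord (k : AdmissibleIndex) : H := (k.1.map z).prod

/-- The `q`-multiple zeta value `ζ_q(k)`; it is `1` for the empty index. -/
def zetaq (q : ℂ) (k : AdmissibleIndex) : ℂ :=
  ∑' n : DecSeq k.1.length,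
    ∏ i : Fin k.1.length, q ^ ((k.1.get i - 1) * n.1 i) / qInt q (n.1 i) ^ k.1.get i

/-- The modified `q`-multiple zeta value `ζ̄_q(k) = (1 - q)^{-|k|} ζ_q(k)`. -/
def zetaqBar (q : ℂ) (k : AdmissibleIndex) : ℂ :=
  ((1 - q) ^ k.weight)⁻¹ * zetaq q k

end

end QMZV

/-!
`Z_q` is multiplicative for both products on `Ĥ⁰`, and both products preserve `Ĥ⁰` and the weight;
hence `Z_q` vanishes on `w * w' - w ш w'`, and `Z̄_q` with it.

*Convergence.* A nested sum over `n₁ > ⋯ > n_r > 0` is the limit of the truncated sums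
`nestedSum`, defined by recursion on the word. The factors `I_u(n)` are bounded, so the inner sums
grow polynomially, while the factor of the first letter of an admissible word is `O(|q|^n)`
(`norm_I_le_geometric`, `nestedSum_norm_bounded`).

*Harmonic product.* On truncated sums the product rule is summation by parts: the increments in the
truncation level of both sides agree, because `∘` represents the product of the functions `I_u`
(`truncZ_succ_circ_mul`, `truncZ_harmWord`). The limit gives `ZFree_harm`.

*Integral shuffle product.* Let `x`, `y`, `ρ` act on power series in `t` as the operators `opX`,
`opY`, `opRho`. A word `w` then has a series `F_w(t)`, and for a word `u₁ ⋯ u_r` in `A` the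
coefficient of `t^n` is the part of the nested sum with `n₁ = n` (`coeff_series_toH_mul`); so `Z_q`
is the sum of the coefficients (`tsum_coeff_series_enc`). Applying `f(t) ↦ f(t) - f(qt)`, which
together with the constant term determines a series, one finds product rules of Rota–Baxter type for
`opX` and `opY`. They are the recursion of the integral shuffle product, so
`F_w F_{w'} = F_{w ш w'}` on `𝔥¹` (`series_shWord`), and summing coefficients gives `ZFree_sh`.

*Closure.* `𝔥¹` is spanned by the words in which each `x` is followed by `x` or `y`
(`wordSpan_goodWord`). As a leading `ρ` can be moved out of a shuffle product, these words are closed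
under `ш`, and a short computation with `ξ = y - ρ` gives the same for `Ĥ⁰` (`sh_mem_H0hat`).
-/

namespace QMZV

noncomputable section

open Filter Topology PowerSeries

/-! ### Nested sums -/

/-- The truncated nested sum `∑_{N > n₁ > ⋯ > n_r ≥ 0} g u₁ n₁ ⋯ g u_r n_r` attached to a word
`u₁ ⋯ u_r`, defined by recursion on the word. -/
def nestedSum {X K : Type} [CommSemiring K] (g : X → ℕ → K) : List X → ℕ → K
  | [], _ => 1
  | a :: u, N => ∑ m ∈ Finset.range N, g a m * nestedSum g u m

/-- The tuples `n₁ > ⋯ > n_r` of natural numbers less than `N`. -/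
def decBox (r N : ℕ) : Finset (Fin r → ℕ) :=
  open Classical in (Fintype.piFinset fun _ => Finset.range N).filter StrictAnti

theorem mem_decBox {r N : ℕ} {n : Fin r → ℕ} :
    n ∈ decBox r N ↔ (∀ i, n i < N) ∧ StrictAnti n := by
  simp [decBox]

theorem strictAnti_cons {r m : ℕ} {n : Fin r → ℕ} :
    StrictAnti (Fin.cons m n : Fin (r + 1) → ℕ) ↔ (∀ i, n i < m) ∧ StrictAnti n := by
  constructor
  · intro h
    refine ⟨fun i => by simpa using h (Fin.succ_pos i), fun i j hij => ?_⟩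
    simpa using h (Fin.succ_lt_succ_iff.2 hij)
  · rintro ⟨h1, h2⟩ i j hij
    induction j using Fin.cases with
    | zero => exact absurd hij (Fin.not_lt_zero i)
    | succ j =>
      induction i using Fin.cases with
      | zero => simpa using h1 j
      | succ i => simpa using h2 (Fin.succ_lt_succ_iff.1 hij)

theorem sum_decBox {X K : Type} [CommSemiring K] (g : X → ℕ → K) (u : List X) (N : ℕ) :
    ∑ n ∈ decBox u.length N, ∏ i, g (u.get i) (n i) = nestedSum g u N := by
  induction u generalizing N with
  | nil =>
    have : decBox ([] : List X).length N = {Fin.elim0} := by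
      ext n
      rw [mem_decBox, Finset.mem_singleton]
      exact ⟨fun _ => funext fun i => i.elim0,
        fun _ => ⟨fun i => i.elim0, fun i => i.elim0⟩⟩
    rw [this]
    simp [nestedSum]
  | cons a u ih =>
    simp only [nestedSum, ← ih, Finset.mul_sum]
    rw [Finset.sum_sigma']
    refine Finset.sum_bij' (fun n _ => ⟨n 0, Fin.tail n⟩) (fun p _ => Fin.cons p.1 p.2) ?_ ?_ ?_ ?_ ?_
    · intro n hn
      rw [mem_decBox] at hn
      obtain ⟨h1, h2⟩ := hn
      rw [← Fin.cons_self_tail n, strictAnti_cons] at h2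
      rw [Finset.mem_sigma, mem_decBox, Finset.mem_range]
      exact ⟨h1 0, h2⟩
    · rintro ⟨m, n⟩ hn
      rw [Finset.mem_sigma, mem_decBox, Finset.mem_range] at hn
      rw [mem_decBox]
      refine ⟨fun i => ?_, strictAnti_cons.2 hn.2⟩
      induction i using Fin.cases with
      | zero => simpa using hn.1
      | succ i => simpa using (hn.2.1 i).trans hn.1
    · intro n _
      exact Fin.cons_self_tail n
    · rintro ⟨m, n⟩ _
      simp
    · intro n _
      exact Fin.prod_univ_succ _

theorem nestedSum_map {X Y K : Type} [CommSemiring K] (g : Y → ℕ → K) (φ : X → Y) (u : List X)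
    (N : ℕ) : nestedSum g (u.map φ) N = nestedSum (fun a => g (φ a)) u N := by
  induction u generalizing N with
  | nil => rfl
  | cons a u ih => simp only [List.map_cons, nestedSum, ih]

theorem nestedSum_norm_nonneg {X : Type} (g : X → ℕ → ℂ) (u : List X) (N : ℕ) :
    0 ≤ nestedSum (fun a n => ‖g a n‖) u N := by
  rw [← sum_decBox]
  positivity

theorem norm_nestedSum_le {X : Type} (g : X → ℕ → ℂ) (u : List X) (N : ℕ) :
    ‖nestedSum g u N‖ ≤ nestedSum (fun a n => ‖g a n‖) u N := by
  rw [← sum_decBox, ← sum_decBox]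
  refine (norm_sum_le _ _).trans_eq ?_
  simp only [norm_prod]

section Convergence

variable {X : Type} (g : X → ℕ → ℂ) (u : List X)

theorem indicator_decSeq_eq (g0 : ∀ a, g a 0 = 0) :
    {n : Fin u.length → ℕ | StrictAnti n ∧ ∀ i, 0 < n i}.indicator
      (fun n => ∏ i, g (u.get i) (n i)) =
    {n : Fin u.length → ℕ | StrictAnti n}.indicator (fun n => ∏ i, g (u.get i) (n i)) := by
  ext n
  by_cases h : StrictAnti n
  · by_cases h' : ∀ i, 0 < n i
    · simp [Set.indicator, h, h']
    · have h0 : ∏ i, g (u.get i) (n i) = 0 := by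
        push Not at h'
        obtain ⟨i, hi⟩ := h'
        exact Finset.prod_eq_zero (Finset.mem_univ i) (by rw [Nat.le_zero.1 hi, g0])
      simp only [Set.indicator, h0, ite_self]
  · simp [Set.indicator, h]

theorem exists_subset_box {r : ℕ} (s : Finset (Fin r → ℕ)) :
    ∃ N, s ⊆ Fintype.piFinset fun _ => Finset.range N := by
  classical
  refine ⟨(s.sup fun n => Finset.univ.sup n) + 1, fun n hn => ?_⟩
  rw [Fintype.mem_piFinset]
  intro i
  rw [Finset.mem_range, Nat.lt_succ_iff]
  exact (Finset.le_sup (f := n) (Finset.mem_univ i)).trans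
    (Finset.le_sup (f := fun n => Finset.univ.sup n) hn)

theorem sum_box_indicator {K : Type} [CommSemiring K] (g : X → ℕ → K) (N : ℕ) :
    ∑ n ∈ Fintype.piFinset (fun _ : Fin u.length => Finset.range N),
      {n : Fin u.length → ℕ | StrictAnti n}.indicator (fun n => ∏ i, g (u.get i) (n i)) n =
    nestedSum g u N := by
  classical
  rw [← sum_decBox, decBox, Finset.sum_filter]
  refine Finset.sum_congr rfl fun n _ => ?_
  simp [Set.indicator]

theorem summable_indicator_strictAnti
    (hb : ∃ c, ∀ N, nestedSum (fun a n => ‖g a n‖) u N ≤ c) :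
    Summable fun n => ‖{n : Fin u.length → ℕ | StrictAnti n}.indicator
      (fun n => ∏ i, g (u.get i) (n i)) n‖ := by
  obtain ⟨c, hc⟩ := hb
  refine summable_of_sum_le (c := c) (fun _ => norm_nonneg _) fun s => ?_
  obtain ⟨N, hN⟩ := exists_subset_box s
  refine (Finset.sum_le_sum_of_subset_of_nonneg hN fun _ _ _ => norm_nonneg _).trans ?_
  refine le_trans (le_of_eq ?_) (hc N)
  rw [← sum_box_indicator]
  refine Finset.sum_congr rfl fun n _ => ?_
  rw [norm_indicator_eq_indicator_norm]
  simp only [norm_prod]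

/-- Bounded nested sums of absolute values give absolute convergence over `DecSeq`. The index `0`,
which `DecSeq` excludes and `nestedSum` includes, is harmless since the factors vanish there. -/
theorem summable_decSeq (g0 : ∀ a, g a 0 = 0)
    (hb : ∃ c, ∀ N, nestedSum (fun a n => ‖g a n‖) u N ≤ c) :
    Summable fun n : DecSeq u.length => ‖∏ i, g (u.get i) (n.1 i)‖ := by
  have h := summable_indicator_strictAnti g u hb
  rw [← indicator_decSeq_eq g u g0] at h
  simp only [norm_indicator_eq_indicator_norm] at h
  have h2 : Summable ((fun n => ‖∏ i, g (u.get i) (n i)‖) ∘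
      ((↑) : {n : Fin u.length → ℕ | StrictAnti n ∧ ∀ i, 0 < n i} → Fin u.length → ℕ)) :=
    summable_subtype_iff_indicator.2 h
  exact h2

theorem tendsto_nestedSum (g0 : ∀ a, g a 0 = 0)
    (hb : ∃ c, ∀ N, nestedSum (fun a n => ‖g a n‖) u N ≤ c) :
    Tendsto (nestedSum g u) atTop
      (𝓝 (∑' n : DecSeq u.length, ∏ i, g (u.get i) (n.1 i))) := by
  have h := (summable_indicator_strictAnti g u hb).of_norm.hasSum
  have e : ∑' n : DecSeq u.length, ∏ i, g (u.get i) (n.1 i) =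
      ∑' n, {n : Fin u.length → ℕ | StrictAnti n}.indicator
        (fun n => ∏ i, g (u.get i) (n i)) n := by
    rw [← indicator_decSeq_eq g u g0]
    exact tsum_subtype {n : Fin u.length → ℕ | StrictAnti n ∧ ∀ i, 0 < n i}
      (fun n => ∏ i, g (u.get i) (n i))
  rw [e]
  have hbox : Tendsto (fun N => Fintype.piFinset (fun _ : Fin u.length => Finset.range N))
      atTop atTop := by
    refine tendsto_atTop_finset_of_monotone (fun M N h => ?_) fun n => ?_
    · exact Fintype.piFinset_subset _ _ fun _ => Finset.range_mono h
    · obtain ⟨N, hN⟩ := exists_subset_box {n}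
      exact ⟨N, hN (Finset.mem_singleton_self n)⟩
  refine (h.comp hbox).congr fun N => ?_
  exact sum_box_indicator u g N

end Convergence

/-! ### Estimates for the summands -/

section Estimates

variable {q : ℂ}

theorem I_zero (q : ℂ) (a : ALetter) : I q a 0 = 0 := by
  cases a with
  | xi => simp [I, qInt]
  | z k hk =>
    have : k ≠ 0 := by omega
    simp [I, qInt, this]

theorem norm_inv_qInt_le (hq1 : ‖q‖ < 1) (n : ℕ) :
    ‖(qInt q n)⁻¹‖ ≤ 2 / (1 - ‖q‖) := by
  have h1 : 0 < 1 - ‖q‖ := by linarith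
  rcases Nat.eq_zero_or_pos n with rfl | hn
  · simp only [qInt, pow_zero, sub_self, zero_div, inv_zero, norm_zero]
    positivity
  · rw [qInt, inv_div, norm_div]
    have h2 : ‖1 - q‖ ≤ 2 := by
      refine (norm_sub_le _ _).trans ?_
      rw [norm_one]; linarith
    have h3 : 1 - ‖q‖ ≤ ‖1 - q ^ n‖ := by
      have := norm_sub_norm_le 1 (q ^ n)
      rw [norm_one, norm_pow] at this
      have h4 := pow_le_of_le_one (norm_nonneg q) hq1.le hn.ne'
      linarith
    gcongr

theorem norm_I_le (hq1 : ‖q‖ < 1) (a : ALetter) : ∃ C, 0 ≤ C ∧ ∀ n, ‖I q a n‖ ≤ C := by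
  have h1 : 0 < 1 - ‖q‖ := by linarith
  refine ⟨(2 / (1 - ‖q‖)) ^ a.weight, by positivity, fun n => ?_⟩
  cases a with
  | xi =>
    simp only [I, ALetter.weight, pow_one, div_eq_mul_inv, norm_mul, norm_pow]
    refine (mul_le_of_le_one_left (norm_nonneg _) (pow_le_one₀ (norm_nonneg _) hq1.le)).trans ?_
    exact norm_inv_qInt_le hq1 n
  | z k hk =>
    simp only [I, ALetter.weight]
    rw [div_eq_mul_inv, ← inv_pow, norm_mul, norm_pow, norm_pow]
    refine (mul_le_of_le_one_left (by positivity) (pow_le_one₀ (norm_nonneg _) hq1.le)).trans ?_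
    exact pow_le_pow_left₀ (norm_nonneg _) (norm_inv_qInt_le hq1 n) k

/-- A letter that may begin an admissible word contributes a geometrically decaying factor. -/
theorem norm_I_le_geometric (hq1 : ‖q‖ < 1) {a : ALetter} {u : List ALetter}
    (ha : AdmissibleWord (a :: u)) : ∃ C, 0 ≤ C ∧ ∀ n, ‖I q a n‖ ≤ C * ‖q‖ ^ n := by
  have h1 : 0 < 1 - ‖q‖ := by linarith
  refine ⟨(2 / (1 - ‖q‖)) ^ a.weight, by positivity, fun n => ?_⟩
  cases a with
  | xi =>
    simp only [I, ALetter.weight, pow_one, div_eq_mul_inv (q ^ n), norm_mul, norm_pow]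
    rw [mul_comm]
    gcongr
    exact norm_inv_qInt_le hq1 n
  | z k hk =>
    have hk2 : 2 ≤ k := ha
    simp only [I, ALetter.weight]
    rw [div_eq_mul_inv, ← inv_pow, norm_mul, norm_pow, norm_pow, mul_comm]
    refine mul_le_mul (pow_le_pow_left₀ (norm_nonneg _) (norm_inv_qInt_le hq1 n) k) ?_
      (by positivity) (by positivity)
    exact pow_le_pow_of_le_one (norm_nonneg _) hq1.le
      (Nat.le_mul_of_pos_left n (by omega))

theorem nestedSum_norm_le (hq1 : ‖q‖ < 1) (u : List ALetter) :
    ∃ C, 0 ≤ C ∧ ∀ N : ℕ, nestedSum (fun a n => ‖I q a n‖) u N ≤ C * (N : ℝ) ^ u.length := by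
  induction u with
  | nil => exact ⟨1, zero_le_one, fun N => by simp [nestedSum]⟩
  | cons a u ih =>
    obtain ⟨C, hC, h⟩ := ih
    obtain ⟨D, hD, h'⟩ := norm_I_le hq1 a
    refine ⟨D * C, by positivity, fun N => ?_⟩
    have : ∀ m ∈ Finset.range N, ‖I q a m‖ * nestedSum (fun a n => ‖I q a n‖) u m ≤
        D * (C * (N : ℝ) ^ u.length) := fun m hm => by
      have hmN : (m : ℝ) ≤ N := by exact_mod_cast (Finset.mem_range.1 hm).le
      refine mul_le_mul (h' m) ((h m).trans ?_) (nestedSum_norm_nonneg _ _ _) hD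
      gcongr
    refine (Finset.sum_le_sum this).trans_eq ?_
    rw [Finset.sum_const, Finset.card_range, nsmul_eq_mul, List.length_cons]
    ring

theorem summable_norm_I_mul_nestedSum (hq1 : ‖q‖ < 1) {a : ALetter} {u : List ALetter}
    (ha : AdmissibleWord (a :: u)) :
    Summable fun m => ‖I q a m‖ * nestedSum (fun a n => ‖I q a n‖) u m := by
  obtain ⟨C, hC, h⟩ := nestedSum_norm_le hq1 u
  obtain ⟨D, hD, h'⟩ := norm_I_le_geometric hq1 ha
  have hs : Summable fun m : ℕ => D * C * ((m : ℝ) ^ u.length * ‖q‖ ^ m) :=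
    (summable_pow_mul_geometric_of_norm_lt_one (R := ℝ) u.length (r := ‖q‖)
      (by rwa [norm_norm])).mul_left (D * C)
  have h0 : ∀ m, 0 ≤ ‖I q a m‖ * nestedSum (fun a n => ‖I q a n‖) u m := fun m =>
    mul_nonneg (norm_nonneg _) (nestedSum_norm_nonneg _ _ _)
  have hle : ∀ m : ℕ, ‖I q a m‖ * nestedSum (fun a n => ‖I q a n‖) u m ≤
      D * C * ((m : ℝ) ^ u.length * ‖q‖ ^ m) := fun m => by
    refine (mul_le_mul (h' m) (h m) (nestedSum_norm_nonneg _ _ _) (by positivity)).trans_eq ?_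
    ring
  exact Summable.of_nonneg_of_le h0 hle hs

theorem nestedSum_norm_bounded (hq1 : ‖q‖ < 1) {u : List ALetter} (hu : AdmissibleWord u) :
    ∃ c, ∀ N, nestedSum (fun a n => ‖I q a n‖) u N ≤ c := by
  cases u with
  | nil => exact ⟨1, fun N => le_rfl⟩
  | cons a u =>
    exact ⟨_, fun N => (summable_norm_I_mul_nestedSum hq1 hu).sum_le_tsum _
      fun m _ => mul_nonneg (norm_nonneg _) (nestedSum_norm_nonneg _ _ _)⟩

theorem tendsto_nestedSum_ZWord (hq1 : ‖q‖ < 1) {u : List ALetter} (hu : AdmissibleWord u) :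
    Tendsto (nestedSum (I q) u) atTop (𝓝 (ZWord q u)) :=
  tendsto_nestedSum (I q) u (I_zero q) (nestedSum_norm_bounded hq1 hu)

end Estimates

/-! ### Linear extensions from words -/

section Extension

variable {X M : Type} [AddCommGroup M] [Module ℂ M]

/-- The `ℚ[ħ]`-linear extension of a map on words to a complex vector space on which `ħ` acts
as `1 - q`. -/
def semiExt (q : ℂ) (φ : List X → M) : FreeAlgebra Coeff X →ₛₗ[evalHbar q] M where
  toFun g := ((wordBasis X).repr g).sum fun u c => evalHbar q c • φ u
  map_add' g g' := by
    rw [map_add, Finsupp.sum_add_index']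
    · intro u
      rw [map_zero, zero_smul]
    · intro u c c'
      rw [map_add, add_smul]
  map_smul' c g := by
    rw [map_smul, Finsupp.sum_smul_index (by simp), Finsupp.sum, Finsupp.sum, Finset.smul_sum]
    simp only [map_mul, mul_smul]

theorem semiExt_word (q : ℂ) (φ : List X → M) (u : List X) : semiExt q φ (word u) = φ u := by
  change ((wordBasis X).repr (word u)).sum (fun u c => evalHbar q c • φ u) = _
  rw [← wordBasis_apply, Module.Basis.repr_self, Finsupp.sum_single_index (by simp), map_one,
    one_smul]

theorem evalHbar_hbar (q : ℂ) : evalHbar q hbar = 1 - q := by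
  simp [evalHbar, hbar]

/-- The span of the words with a given property. -/
def wordSpan (p : List X → Prop) : Submodule Coeff (FreeAlgebra Coeff X) :=
  Submodule.span Coeff {g | ∃ u, p u ∧ g = word u}

theorem word_mem_wordSpan {p : List X → Prop} {u : List X} (hu : p u) : word u ∈ wordSpan p :=
  Submodule.subset_span ⟨u, hu, rfl⟩

theorem mem_wordSpan_true (g : FreeAlgebra Coeff X) : g ∈ wordSpan fun _ : List X => True := by
  have h : g ∈ Submodule.span Coeff (Set.range (wordBasis X)) := by
    rw [Module.Basis.span_eq]; trivial
  refine Submodule.span_mono ?_ h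
  rintro _ ⟨u, rfl⟩
  exact ⟨u, trivial, wordBasis_apply u⟩

theorem mul_mem_of_word {p : List X → Prop} {N : Submodule Coeff (FreeAlgebra Coeff X)}
    {a : FreeAlgebra Coeff X} (h : ∀ u, p u → a * word u ∈ N) {g : FreeAlgebra Coeff X}
    (hg : g ∈ wordSpan p) : a * g ∈ N := by
  have : wordSpan p ≤ N.comap (LinearMap.mulLeft Coeff a) := by
    refine Submodule.span_le.2 ?_
    rintro _ ⟨u, hu, rfl⟩
    exact h u hu
  exact this hg

theorem bilinExtend_mem {p p' : List X → Prop} {f : List X → List X → FreeAlgebra Coeff X}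
    {N : Submodule Coeff (FreeAlgebra Coeff X)} (h : ∀ u u', p u → p' u' → f u u' ∈ N)
    {g g' : FreeAlgebra Coeff X} (hg : g ∈ wordSpan p) (hg' : g' ∈ wordSpan p') :
    bilinExtend f g g' ∈ N := by
  refine LinearMap.BilinMap.apply_apply_mem_of_mem_span N _ _ (bilinExtend f) ?_ g g' hg hg'
  rintro _ ⟨u, hu, rfl⟩ _ ⟨u', hu', rfl⟩
  rw [bilinExtend_word]
  exact h u u' hu hu'

/-- A map that is multiplicative on certain words is multiplicative on their span. -/
theorem map_bilinExtend {R : Type} [CommRing R] [Algebra ℂ R] {q : ℂ}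
    (Φ : FreeAlgebra Coeff X →ₛₗ[evalHbar q] R) {p : List X → Prop}
    {f : List X → List X → FreeAlgebra Coeff X}
    (h : ∀ u u', p u → p u' → Φ (f u u') = Φ (word u) * Φ (word u'))
    {g g' : FreeAlgebra Coeff X} (hg : g ∈ wordSpan p) (hg' : g' ∈ wordSpan p) :
    Φ (bilinExtend f g g') = Φ g * Φ g' := by
  induction hg using Submodule.span_induction with
  | mem g hg =>
    obtain ⟨u, hu, rfl⟩ := hg
    induction hg' using Submodule.span_induction with
    | mem g' hg' =>
      obtain ⟨u', hu', rfl⟩ := hg'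
      rw [bilinExtend_word, h u u' hu hu']
    | zero => simp
    | add a b _ _ ha hb => rw [map_add, map_add, map_add, ha, hb, mul_add]
    | smul c a _ ha => rw [map_smul, map_smulₛₗ, map_smulₛₗ, ha, mul_smul_comm]
  | zero => simp
  | add a b _ _ ha hb =>
    rw [map_add, LinearMap.add_apply, map_add, map_add, ha, hb, add_mul]
  | smul c a _ ha =>
    rw [map_smul, LinearMap.smul_apply, map_smulₛₗ, map_smulₛₗ, ha, smul_mul_assoc]

end Extension

/-! ### The harmonic product -/

/-- The truncated version of `Z_q`, in which all summation indices are less than `N`. -/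
def truncZ (q : ℂ) (N : ℕ) : FA →ₛₗ[evalHbar q] ℂ :=
  semiExt q fun u => nestedSum (I q) u N

theorem truncZ_word (q : ℂ) (N : ℕ) (u : List ALetter) :
    truncZ q N (word u) = nestedSum (I q) u N := semiExt_word _ _ _

theorem truncZ_zero_ι_mul (q : ℂ) (a : ALetter) (g : FA) :
    truncZ q 0 (FreeAlgebra.ι Coeff a * g) = 0 := by
  induction mem_wordSpan_true g using Submodule.span_induction with
  | mem g h =>
    obtain ⟨u, _, rfl⟩ := h
    rw [← word_cons, truncZ_word, nestedSum, Finset.sum_range_zero]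
  | zero => simp
  | add g g' _ _ h h' => rw [mul_add, map_add, h, h', add_zero]
  | smul c g _ h => rw [mul_smul_comm, map_smulₛₗ, h, smul_zero]

theorem truncZ_succ_ι_mul (q : ℂ) (N : ℕ) (a : ALetter) (g : FA) :
    truncZ q (N + 1) (FreeAlgebra.ι Coeff a * g) =
      truncZ q N (FreeAlgebra.ι Coeff a * g) + I q a N * truncZ q N g := by
  induction mem_wordSpan_true g using Submodule.span_induction with
  | mem g h =>
    obtain ⟨u, _, rfl⟩ := h
    rw [← word_cons, truncZ_word, truncZ_word, truncZ_word, nestedSum, Finset.sum_range_succ,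
      nestedSum]
  | zero => simp
  | add g g' _ _ h h' => simp only [mul_add, map_add, h, h']; ring
  | smul c g _ h => simp only [mul_smul_comm, map_smulₛₗ, h, smul_eq_mul]; ring

theorem qInt_ne_zero {q : ℂ} (hq1 : ‖q‖ < 1) {n : ℕ} (hn : n ≠ 0) : qInt q n ≠ 0 := by
  have h : ∀ m, m ≠ 0 → 1 - q ^ m ≠ 0 := fun m hm h => by
    have h1 : ‖q ^ m‖ = 1 := by rw [← sub_eq_zero.1 h, norm_one]
    rw [norm_pow] at h1
    exact absurd h1 (pow_lt_one₀ (norm_nonneg _) hq1 hm).ne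
  rw [qInt]
  exact div_ne_zero (h n hn) (by simpa using h 1 one_ne_zero)

theorem one_sub_ne_zero_of_norm_lt_one {q : ℂ} (hq1 : ‖q‖ < 1) : 1 - q ≠ 0 := fun h => by
  rw [← sub_eq_zero.1 h, norm_one] at hq1
  exact lt_irrefl _ hq1

theorem one_sub_mul_qInt {q : ℂ} (hq1 : ‖q‖ < 1) (n : ℕ) : (1 - q) * qInt q n = 1 - q ^ n :=
  mul_div_cancel₀ _ (one_sub_ne_zero_of_norm_lt_one hq1)

theorem truncZ_zero_circ_mul (q : ℂ) (a b : ALetter) (g : FA) :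
    truncZ q 0 (circ a b * g) = 0 := by
  cases a <;> cases b <;>
    simp [circ, add_mul, sub_mul, truncZ_zero_ι_mul, map_smulₛₗ]

/-- The product `∘` of letters represents the product of the functions `n ↦ I_u(n)`. -/
theorem truncZ_succ_circ_mul {q : ℂ} (hq1 : ‖q‖ < 1) (N : ℕ) (a b : ALetter) (g : FA) :
    truncZ q (N + 1) (circ a b * g) =
      truncZ q N (circ a b * g) + I q a N * I q b N * truncZ q N g := by
  rcases eq_or_ne N 0 with rfl | hN
  · have : truncZ q 1 (circ a b * g) = 0 := by
      cases a <;> cases b <;>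
        simp [circ, add_mul, sub_mul, truncZ_succ_ι_mul q 0, truncZ_zero_ι_mul,
          map_smulₛₗ, I_zero]
    rw [zero_add, this, truncZ_zero_circ_mul, I_zero]
    simp
  have h0 := qInt_ne_zero hq1 hN
  have h1 : q ^ N = 1 - (1 - q) * qInt q N := by rw [one_sub_mul_qInt hq1]; ring
  rcases a with _ | ⟨k, hk⟩ <;> rcases b with _ | ⟨l, hl⟩
  · simp only [circ, sub_mul, smul_mul_assoc, map_sub, map_smulₛₗ, truncZ_succ_ι_mul, smul_eq_mul,
      evalHbar_hbar, I]
    have : (1 - q) * (q ^ N / qInt q N) = q ^ N / qInt q N ^ 2 - q ^ N * q ^ N / qInt q N ^ 2 := by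
      nth_rewrite 3 [h1]
      field_simp
      ring
    have e : q ^ ((2 - 1) * N) = q ^ N := by norm_num
    rw [e]
    linear_combination (-truncZ q N g) * this
  · obtain ⟨l, rfl⟩ := Nat.exists_eq_add_of_le' hl
    simp only [circ, truncZ_succ_ι_mul, I, Nat.add_sub_cancel]
    congr 2
    rw [add_mul, one_mul, pow_add]
    field_simp
    ring
  · obtain ⟨k, rfl⟩ := Nat.exists_eq_add_of_le' hk
    simp only [circ, truncZ_succ_ι_mul, I, Nat.add_sub_cancel]
    congr 2
    rw [add_mul, one_mul, pow_add]
    field_simp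
    ring
  · obtain ⟨l, rfl⟩ := Nat.exists_eq_add_of_le' hl
    obtain ⟨k, rfl⟩ := Nat.exists_eq_add_of_le' hk
    simp only [circ, add_mul, smul_mul_assoc, map_add, map_smulₛₗ, truncZ_succ_ι_mul, smul_eq_mul,
      evalHbar_hbar, I]
    have e1 : k + 1 + (l + 1) - 1 = k + l + 1 := by omega
    simp only [e1, Nat.add_sub_cancel]
    have : q ^ ((k + l + 1) * N) / qInt q N ^ (k + 1 + (l + 1)) +
        (1 - q) * (q ^ ((k + l) * N) / qInt q N ^ (k + l + 1)) =
        q ^ (k * N) / qInt q N ^ (k + 1) * (q ^ (l * N) / qInt q N ^ (l + 1)) := by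
      rw [add_mul (k + l), one_mul, pow_add q, h1, add_mul, pow_add q]
      field_simp
      ring
    rw [← this]
    ring

theorem truncZ_one (q : ℂ) (N : ℕ) : truncZ q N 1 = 1 := by
  rw [← word_nil, truncZ_word, nestedSum]

theorem harmWord_nil_left (u : List ALetter) : harmWord [] u = word u := by
  rw [harmWord]

theorem harmWord_nil_right (u : List ALetter) : harmWord u [] = word u := by
  cases u <;> rw [harmWord]

theorem harmWord_cons (a b : ALetter) (u v : List ALetter) : harmWord (a :: u) (b :: v) =
    FreeAlgebra.ι Coeff a * harmWord u (b :: v) + FreeAlgebra.ι Coeff b * harmWord (a :: u) v +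
      circ a b * harmWord u v := by
  rw [harmWord]

/-- Truncated sums turn the harmonic product into the product of numbers: both sides have the same
increment in the truncation level. -/
theorem truncZ_harmWord {q : ℂ} (hq1 : ‖q‖ < 1) (N : ℕ) (u v : List ALetter) :
    truncZ q N (harmWord u v) = truncZ q N (word u) * truncZ q N (word v) := by
  induction N generalizing u v with
  | zero =>
    cases u with
    | nil => rw [harmWord_nil_left, word_nil, truncZ_one, one_mul]
    | cons a u =>
      cases v with
      | nil => rw [harmWord_nil_right, word_nil, truncZ_one, mul_one]
      | cons b v =>
        rw [harmWord_cons, map_add, map_add, truncZ_zero_ι_mul, truncZ_zero_ι_mul,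
          truncZ_zero_circ_mul, word_cons, truncZ_zero_ι_mul]
        simp
  | succ N ih =>
    cases u with
    | nil => rw [harmWord_nil_left, word_nil, truncZ_one, one_mul]
    | cons a u =>
      cases v with
      | nil => rw [harmWord_nil_right, word_nil, truncZ_one, mul_one]
      | cons b v =>
        have h := ih (a :: u) (b :: v)
        rw [harmWord_cons, map_add, map_add] at h ⊢
        rw [truncZ_succ_ι_mul, truncZ_succ_ι_mul, truncZ_succ_circ_mul hq1, ih, ih, ih,
          word_cons a u, word_cons b v, truncZ_succ_ι_mul, truncZ_succ_ι_mul,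
          ← word_cons a u, ← word_cons b v]
        linear_combination h

/-- The span of the admissible words: `Ĥ⁰` inside the free algebra on `A`. -/
abbrev admissibleSpan : Submodule Coeff FA := wordSpan AdmissibleWord

theorem ι_mul_mem_admissibleSpan {a : ALetter} (ha : ∀ u, AdmissibleWord (a :: u)) (g : FA) :
    FreeAlgebra.ι Coeff a * g ∈ admissibleSpan := by
  refine mul_mem_of_word (fun u _ => ?_) (mem_wordSpan_true g)
  rw [← word_cons]
  exact word_mem_wordSpan (ha u)

theorem ι_z_mul_mem_admissibleSpan {k : ℕ} (hk : 1 ≤ k) (hk2 : 2 ≤ k) (g : FA) :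
    FreeAlgebra.ι Coeff (ALetter.z k hk) * g ∈ admissibleSpan :=
  ι_mul_mem_admissibleSpan (a := ALetter.z k hk) (fun _ => hk2) g

theorem circ_mul_mem_admissibleSpan {a b : ALetter} (ha : ∀ u, AdmissibleWord (a :: u))
    (hb : ∀ u, AdmissibleWord (b :: u)) (g : FA) : circ a b * g ∈ admissibleSpan := by
  rcases a with _ | ⟨k, hk⟩ <;> rcases b with _ | ⟨l, hl⟩ <;>
    simp only [circ, add_mul, sub_mul, smul_mul_assoc]
  · exact Submodule.sub_mem _ (ι_z_mul_mem_admissibleSpan _ le_rfl g)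
      (Submodule.smul_mem _ _ (ι_mul_mem_admissibleSpan hb g))
  · exact ι_z_mul_mem_admissibleSpan _ (by omega) g
  · exact ι_z_mul_mem_admissibleSpan _ (by omega) g
  · have hk2 : 2 ≤ k := ha []
    have hl2 : 2 ≤ l := hb []
    exact Submodule.add_mem _ (ι_z_mul_mem_admissibleSpan _ (by omega) g)
      (Submodule.smul_mem _ _ (ι_z_mul_mem_admissibleSpan _ (by omega) g))

theorem AdmissibleWord.of_head {a : ALetter} {u : List ALetter} (h : AdmissibleWord (a :: u))
    (v : List ALetter) : AdmissibleWord (a :: v) := by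
  cases a <;> exact h

theorem harmWord_mem_admissibleSpan {u v : List ALetter} (hu : AdmissibleWord u)
    (hv : AdmissibleWord v) : harmWord u v ∈ admissibleSpan := by
  cases u with
  | nil => rw [harmWord_nil_left]; exact word_mem_wordSpan hv
  | cons a u =>
    cases v with
    | nil => rw [harmWord_nil_right]; exact word_mem_wordSpan hu
    | cons b v =>
      rw [harmWord_cons]
      exact Submodule.add_mem _ (Submodule.add_mem _ (ι_mul_mem_admissibleSpan hu.of_head _)
        (ι_mul_mem_admissibleSpan hv.of_head _))
        (circ_mul_mem_admissibleSpan hu.of_head hv.of_head _)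

theorem ZFree_word (q : ℂ) (u : List ALetter) : ZFree q (word u) = ZWord q u := by
  rw [← one_smul Coeff (word u), ZFree_smul_word, map_one, one_mul]

theorem tendsto_truncZ {q : ℂ} (hq1 : ‖q‖ < 1) {g : FA} (hg : g ∈ admissibleSpan) :
    Tendsto (fun N => truncZ q N g) atTop (𝓝 (ZFree q g)) := by
  induction hg using Submodule.span_induction with
  | mem g h =>
    obtain ⟨u, hu, rfl⟩ := h
    rw [ZFree_word]
    simp only [truncZ_word]
    exact tendsto_nestedSum_ZWord hq1 hu
  | zero => simp
  | add g g' _ _ h h' => simpa only [map_add] using h.add h'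
  | smul c g _ h => simpa only [map_smulₛₗ] using h.const_smul (evalHbar q c)

/-- `Z_q` is multiplicative for the harmonic product, as the limit of the truncated maps. -/
theorem ZFree_harm {q : ℂ} (hq1 : ‖q‖ < 1) {g g' : FA} (hg : g ∈ admissibleSpan)
    (hg' : g' ∈ admissibleSpan) :
    ZFree q (bilinExtend harmWord g g') = ZFree q g * ZFree q g' := by
  have h := tendsto_truncZ hq1
    (bilinExtend_mem (fun _ _ => harmWord_mem_admissibleSpan) hg hg')
  refine tendsto_nhds_unique h (((tendsto_truncZ hq1 hg).mul (tendsto_truncZ hq1 hg')).congr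
    fun N => ?_)
  exact (map_bilinExtend (truncZ q N) (fun u u' _ _ => truncZ_harmWord hq1 N u u')
    (mem_wordSpan_true g) (mem_wordSpan_true g')).symm

/-! ### Jackson integral operators on power series -/

section Operators

variable (q : ℂ)

/-- The operator `t^n ↦ q^n / [n] t^n` representing the letter `x`. On series without constant
term it is the Jackson integral `f(t) ↦ (1 - q) ∑_{j ≥ 1} f(q^j t)`; the constant term is sent
to zero. -/
def opX (f : ℂ⟦X⟧) : ℂ⟦X⟧ := PowerSeries.mk fun n => q ^ n / qInt q n * coeff n f

/-- Multiplication by `(1 - q) t / (1 - t)`, representing the letter `ρ`. -/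
def opRho (f : ℂ⟦X⟧) : ℂ⟦X⟧ :=
  PowerSeries.mk fun n => (1 - q) * ∑ m ∈ Finset.range n, coeff m f

/-- The operator representing the letter `y`: multiplication by `t / (1 - t)` followed by
`t^n ↦ 1 / [n] t^n`, that is, `f(t) ↦ (1 - q) ∑_{j ≥ 0} q^j t / (1 - q^j t) f(q^j t)`. -/
def opY (f : ℂ⟦X⟧) : ℂ⟦X⟧ :=
  PowerSeries.mk fun n => (qInt q n)⁻¹ * ∑ m ∈ Finset.range n, coeff m f

theorem opRho_eq (f : ℂ⟦X⟧) :
    opRho q f = PowerSeries.C (1 - q) * (f * (PowerSeries.X * PowerSeries.mk 1)) := by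
  ext n
  rw [opRho, coeff_mk, coeff_C_mul]
  congr 1
  rw [mul_left_comm]
  cases n with
  | zero => simp
  | succ n =>
    rw [coeff_succ_X_mul, coeff_mul, Finset.Nat.sum_antidiagonal_eq_sum_range_succ_mk]
    simp

theorem mul_opRho (f g : ℂ⟦X⟧) : f * opRho q g = opRho q (f * g) := by
  simp only [opRho_eq]
  ring

theorem opRho_mul (f g : ℂ⟦X⟧) : opRho q f * g = opRho q (f * g) := by
  simp only [opRho_eq]
  ring

theorem opX_add (f g : ℂ⟦X⟧) : opX q (f + g) = opX q f + opX q g := by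
  ext n; simp [opX, mul_add]

theorem opX_smul (c : ℂ) (f : ℂ⟦X⟧) : opX q (c • f) = c • opX q f := by
  ext n; simp [opX, mul_left_comm]

theorem opY_add (f g : ℂ⟦X⟧) : opY q (f + g) = opY q f + opY q g := by
  ext n; simp [opY, mul_add, Finset.sum_add_distrib]

theorem opY_smul (c : ℂ) (f : ℂ⟦X⟧) : opY q (c • f) = c • opY q f := by
  ext n; simp [opY, mul_left_comm, ← Finset.mul_sum]

theorem opRho_add (f g : ℂ⟦X⟧) : opRho q (f + g) = opRho q f + opRho q g := by
  simp only [opRho_eq]; ring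

theorem opRho_smul (c : ℂ) (f : ℂ⟦X⟧) : opRho q (c • f) = c • opRho q f := by
  simp only [opRho_eq, smul_mul_assoc, mul_smul_comm]

variable {q}

theorem constantCoeff_opX (f : ℂ⟦X⟧) : constantCoeff (opX q f) = 0 := by
  rw [← coeff_zero_eq_constantCoeff_apply]
  simp [opX, qInt]

theorem constantCoeff_opY (f : ℂ⟦X⟧) : constantCoeff (opY q f) = 0 := by
  rw [← coeff_zero_eq_constantCoeff_apply]
  simp [opY]

theorem constantCoeff_opRho (f : ℂ⟦X⟧) : constantCoeff (opRho q f) = 0 := by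
  rw [← coeff_zero_eq_constantCoeff_apply]
  simp [opRho]

/-- A series is determined by its constant term and its `q`-difference `f(t) - f(qt)`. -/
theorem eq_of_qDifference (hq1 : ‖q‖ < 1) {f g : ℂ⟦X⟧} (h0 : constantCoeff f = constantCoeff g)
    (h : f - rescale q f = g - rescale q g) : f = g := by
  ext n
  rcases eq_or_ne n 0 with rfl | hn
  · simpa only [coeff_zero_eq_constantCoeff_apply] using h0
  · have h1 := congrArg (coeff n) h
    simp only [map_sub, coeff_rescale] at h1
    have h2 : (1 - q ^ n) ≠ 0 := by
      rw [← one_sub_mul_qInt hq1]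
      exact mul_ne_zero (one_sub_ne_zero_of_norm_lt_one hq1) (qInt_ne_zero hq1 hn)
    refine mul_left_cancel₀ h2 ?_
    linear_combination h1

/-- The Jackson integral `a = opX q f` solves `a(t) - a(qt) = (1 - q) f(qt)`. -/
theorem opX_eq (hq1 : ‖q‖ < 1) {f : ℂ⟦X⟧} (hf : constantCoeff f = 0) :
    opX q f = rescale q (opX q f) + PowerSeries.C (1 - q) * rescale q f := by
  ext n
  simp only [map_add, coeff_rescale, coeff_C_mul, opX, coeff_mk]
  rcases eq_or_ne n 0 with rfl | hn
  · rw [coeff_zero_eq_constantCoeff_apply, hf]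
    simp
  · have h0 := qInt_ne_zero hq1 hn
    field_simp
    linear_combination (-q ^ n * coeff n f) * one_sub_mul_qInt hq1 n

/-- `a = opY q f` solves `a(t) - a(qt) = (1 - q) t / (1 - t) f(t)`. -/
theorem opY_eq (hq1 : ‖q‖ < 1) (f : ℂ⟦X⟧) :
    opY q f = rescale q (opY q f) + opRho q f := by
  ext n
  simp only [map_add, coeff_rescale, opRho, opY, coeff_mk]
  rcases eq_or_ne n 0 with rfl | hn
  · simp
  · have h0 := qInt_ne_zero hq1 hn
    field_simp
    linear_combination (-∑ m ∈ Finset.range n, coeff m f) * one_sub_mul_qInt hq1 n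

/-- The Rota–Baxter identity for the Jackson integral. -/
theorem opX_mul_opX (hq1 : ‖q‖ < 1) {f g : ℂ⟦X⟧} (hf : constantCoeff f = 0)
    (hg : constantCoeff g = 0) : opX q f * opX q g =
      opX q (f * opX q g) + opX q (opX q f * g) + (1 - q) • opX q (f * g) := by
  rw [← opX_smul, ← opX_add, ← opX_add]
  refine eq_of_qDifference hq1 ?_ ?_
  · simp only [map_mul, constantCoeff_opX, mul_zero]
  have hc : constantCoeff (f * opX q g + opX q f * g + (1 - q) • (f * g)) = 0 := by
    rw [smul_eq_C_mul]
    simp [hf, hg]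
  have h := opX_eq hq1 hc
  have h1 := opX_eq hq1 hf
  have h2 := opX_eq hq1 hg
  rw [smul_eq_C_mul] at h ⊢
  have hC : rescale q (PowerSeries.C (1 - q)) = PowerSeries.C (1 - q) := by
    ext n
    rw [coeff_rescale, coeff_C]
    split_ifs with hn <;> simp [hn]
  simp only [map_add, map_mul, hC] at h ⊢
  linear_combination opX q g * h1 +
    (rescale q (opX q f) + PowerSeries.C (1 - q) * rescale q f) * h2 - h

theorem opX_mul_opY (hq1 : ‖q‖ < 1) {f : ℂ⟦X⟧} (g : ℂ⟦X⟧) (hf : constantCoeff f = 0) :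
    opX q f * opY q g = opX q (f * opY q g) + opY q (opX q f * g) := by
  refine eq_of_qDifference hq1 ?_ ?_
  · simp only [map_mul, map_add, constantCoeff_opX, constantCoeff_opY, mul_zero, add_zero]
  have hc : constantCoeff (f * opY q g) = 0 := by simp [hf]
  have h := opX_eq hq1 hc
  have h' := opY_eq hq1 (opX q f * g)
  have h1 := opX_eq hq1 hf
  have h2 := opY_eq hq1 g
  rw [← mul_opRho] at h'
  simp only [map_add, map_mul] at h ⊢
  linear_combination (opY q g - opRho q g) * h1 +
    (rescale q (opX q f) + PowerSeries.C (1 - q) * rescale q f) * h2 - h - h'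

theorem opY_mul_opY (hq1 : ‖q‖ < 1) (f g : ℂ⟦X⟧) :
    opY q f * opY q g =
      opY q (f * opY q g) + opY q (opY q f * g) - opY q (opRho q (f * g)) := by
  refine eq_of_qDifference hq1 ?_ ?_
  · simp only [map_mul, map_add, map_sub, constantCoeff_opY, mul_zero, add_zero, sub_zero]
  have h3 := opY_eq hq1 (f * opY q g)
  have h4 := opY_eq hq1 (opY q f * g)
  have h5 := opY_eq hq1 (opRho q (f * g))
  have h1 := opY_eq hq1 f
  have h2 := opY_eq hq1 g
  rw [← opRho_mul] at h3
  rw [← mul_opRho] at h4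
  have e : opRho q (opRho q (f * g)) = opRho q f * opRho q g := by rw [mul_opRho, opRho_mul]
  rw [e] at h5
  simp only [map_add, map_mul, map_sub]
  linear_combination (opY q g - opRho q g) * h1 + rescale q (opY q f) * h2 - h3 - h4 + h5

end Operators

/-! ### The integral shuffle product and power series -/

/-- The operator on power series represented by a letter. -/
def letterOp (q : ℂ) : Letter → ℂ⟦X⟧ → ℂ⟦X⟧
  | Letter.x => opX q
  | Letter.y => opY q
  | Letter.rho => opRho q

/-- The power series of an element of `𝔥`: words in `x`, `y`, `ρ` act on the constant series `1`
through the operators represented by their letters. -/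
def series (q : ℂ) : H →ₛₗ[evalHbar q] ℂ⟦X⟧ :=
  semiExt q fun w => w.foldr (letterOp q) 1

theorem series_one (q : ℂ) : series q 1 = 1 := by
  rw [← word_nil, series, semiExt_word, List.foldr_nil]

theorem series_ι_mul (q : ℂ) (a : Letter) (h : H) :
    series q (FreeAlgebra.ι Coeff a * h) = letterOp q a (series q h) := by
  have hadd : ∀ f g, letterOp q a (f + g) = letterOp q a f + letterOp q a g := by
    cases a
    exacts [opX_add q, opY_add q, opRho_add q]
  have hsmul : ∀ (c : ℂ) f, letterOp q a (c • f) = c • letterOp q a f := by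
    cases a
    exacts [opX_smul q, opY_smul q, opRho_smul q]
  induction mem_wordSpan_true h using Submodule.span_induction with
  | mem h hh =>
    obtain ⟨u, _, rfl⟩ := hh
    rw [← word_cons, series, semiExt_word, semiExt_word, List.foldr_cons]
  | zero =>
    have := hsmul 0 0
    rw [zero_smul, zero_smul] at this
    rw [mul_zero, map_zero, this]
  | add g g' _ _ h h' => rw [mul_add, map_add, map_add, h, h', hadd]
  | smul c g _ h => rw [mul_smul_comm, map_smulₛₗ, map_smulₛₗ, h, hsmul]

theorem series_x_mul (q : ℂ) (h : H) : series q (x * h) = opX q (series q h) :=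
  series_ι_mul q Letter.x h

theorem series_y_mul (q : ℂ) (h : H) : series q (y * h) = opY q (series q h) :=
  series_ι_mul q Letter.y h

theorem series_rho_mul (q : ℂ) (h : H) : series q (rho * h) = opRho q (series q h) :=
  series_ι_mul q Letter.rho h

theorem neg_mul_rho_mul (a : Letter) (h : H) :
    -(FreeAlgebra.ι Coeff a * rho) * h = -(FreeAlgebra.ι Coeff a * (rho * h)) :=
  (neg_mul (FreeAlgebra.ι Coeff a * rho) h).trans (by rw [mul_assoc])

theorem series_neg_ι_mul_rho_mul (q : ℂ) (a : Letter) (h : H) :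
    series q (-(FreeAlgebra.ι Coeff a * rho) * h) = -letterOp q a (opRho q (series q h)) := by
  rw [neg_mul_rho_mul, map_neg, series_ι_mul, series_rho_mul]

/-- The word starts with `x` or `y`. -/
def StartsXY : List Letter → Prop
  | Letter.x :: _ => True
  | Letter.y :: _ => True
  | _ => False

/-- Each `x` in the word is followed by `x` or `y`. These words form a basis of `𝔥¹`
(see `wordSpan_goodWord`). -/
def GoodWord : List Letter → Prop
  | [] => True
  | Letter.x :: w => StartsXY w ∧ GoodWord w
  | _ :: w => GoodWord w

theorem GoodWord.tail {a : Letter} {w : List Letter} (h : GoodWord (a :: w)) : GoodWord w := by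
  cases a
  exacts [h.2, h, h]

theorem shWord_nil_left (w : List Letter) : shWord [] w = word w := by
  rw [shWord]

theorem shWord_nil_right (w : List Letter) : shWord w [] = word w := by
  cases w <;> rw [shWord]

theorem shWord_cons (a b : Letter) (u v : List Letter) : shWord (a :: u) (b :: v) =
    FreeAlgebra.ι Coeff a * shWord u (b :: v) + FreeAlgebra.ι Coeff b * shWord (a :: u) v +
      alpha a b * shWord u v := by
  rw [shWord]

theorem constantCoeff_letterOp (q : ℂ) (a : Letter) (f : ℂ⟦X⟧) :
    constantCoeff (letterOp q a f) = 0 := by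
  cases a
  exacts [constantCoeff_opX f, constantCoeff_opY f, constantCoeff_opRho f]

theorem constantCoeff_series_word {q : ℂ} {w : List Letter} (hw : StartsXY w) :
    constantCoeff (series q (word w)) = 0 := by
  cases w with
  | nil => exact hw.elim
  | cons a w =>
    rw [word_cons, series_ι_mul, constantCoeff_letterOp]

/-- The power series turn the integral shuffle product into multiplication. Words ending in `x` are
excluded because the identities for `opX` need series without constant term. -/
theorem series_shWord {q : ℂ} (hq1 : ‖q‖ < 1) : ∀ {u v : List Letter}, GoodWord u → GoodWord v →
    series q (shWord u v) = series q (word u) * series q (word v)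
  | [], v, _, _ => by rw [shWord_nil_left, word_nil, series_one, one_mul]
  | a :: u, [], _, _ => by rw [shWord_nil_right, word_nil, series_one, mul_one]
  | a :: u, b :: v, hu, hv => by
    rw [shWord_cons, map_add, map_add, series_ι_mul, series_ι_mul, series_shWord hq1 hu.tail hv,
      series_shWord hq1 hu hv.tail, word_cons a u, word_cons b v, series_ι_mul, series_ι_mul]
    have ih := series_shWord hq1 hu.tail hv.tail
    cases a <;> cases b <;>
      simp only [alpha, y, series_neg_ι_mul_rho_mul, letterOp, smul_mul_assoc, zero_mul, map_zero,
        map_smulₛₗ, series_x_mul, ih, evalHbar_hbar]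
    · rw [opX_mul_opX hq1 (constantCoeff_series_word hu.1) (constantCoeff_series_word hv.1)]
    · rw [opX_mul_opY hq1 _ (constantCoeff_series_word hu.1), add_zero]
    · rw [mul_opRho, mul_opRho]
      ring
    · rw [mul_comm (opY q _) (opX q _), opX_mul_opY hq1 _ (constantCoeff_series_word hv.1),
        add_zero, mul_comm (series q (word v)), mul_comm (opX q _), add_comm]
    · rw [opY_mul_opY hq1]
      ring
    · rw [mul_opRho, mul_opRho]
      ring
    · rw [opRho_mul, opRho_mul]
      ring
    · rw [opRho_mul, opRho_mul]
      ring
    · rw [mul_opRho, mul_opRho]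
      ring
  termination_by u v => u.length + v.length

/-! ### `Z_q` as a sum of power series coefficients -/

theorem enc_word_cons (a : ALetter) (u : List ALetter) :
    enc (word (a :: u)) = a.toH * enc (word u) := by
  rw [word_cons, map_mul, enc, FreeAlgebra.lift_ι_apply]

/-- Multiplication by a letter `u` of `A` acts on coefficient sequences as a step of the nested sum
with factor `I_u(n)`. -/
theorem coeff_series_toH_mul {q : ℂ} (hq1 : ‖q‖ < 1) (a : ALetter) (h : H) (n : ℕ) :
    coeff n (series q (a.toH * h)) =
      I q a n * ∑ m ∈ Finset.range n, coeff m (series q h) := by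
  rcases eq_or_ne n 0 with rfl | hn
  · rw [I_zero, zero_mul]
    cases a with
    | xi => simp [ALetter.toH, QMZV.xi, sub_mul, series_y_mul, series_rho_mul, opY, opRho]
    | z k hk =>
      rw [ALetter.toH, QMZV.z, mul_assoc]
      cases k - 1 with
      | zero => simp [series_y_mul, opY]
      | succ j => simp [pow_succ', mul_assoc, series_x_mul, opX, qInt]
  · have h0 := qInt_ne_zero hq1 hn
    cases a with
    | xi =>
      rw [ALetter.toH, QMZV.xi, sub_mul, map_sub, series_y_mul, series_rho_mul, map_sub, opY, opRho,
        coeff_mk, coeff_mk, ← sub_mul, I]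
      congr 1
      field_simp
      linear_combination (-1 : ℂ) * one_sub_mul_qInt hq1 n
    | z k hk =>
      obtain ⟨j, rfl⟩ := Nat.exists_eq_add_of_le' hk
      rw [ALetter.toH, QMZV.z, mul_assoc, Nat.add_sub_cancel, I, Nat.add_sub_cancel]
      have key : ∀ i : ℕ, coeff n (series q (x ^ i * (y * h))) =
          (q ^ n / qInt q n) ^ i * ((qInt q n)⁻¹ * ∑ m ∈ Finset.range n, coeff m (series q h)) := by
        intro i
        induction i with
        | zero => rw [pow_zero, one_mul, pow_zero, one_mul, series_y_mul, opY, coeff_mk]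
        | succ i ih => rw [pow_succ', mul_assoc, series_x_mul, opX, coeff_mk, ih, pow_succ' (_ / _),
            mul_assoc]
      rw [key, mul_comm j n, pow_mul, div_pow, pow_succ (qInt q n)]
      field_simp

theorem sum_coeff_series_enc {q : ℂ} (hq1 : ‖q‖ < 1) (u : List ALetter) {n : ℕ} (hn : n ≠ 0) :
    ∑ m ∈ Finset.range n, coeff m (series q (enc (word u))) = nestedSum (I q) u n := by
  induction u generalizing n with
  | nil =>
    obtain ⟨n, rfl⟩ := Nat.exists_eq_succ_of_ne_zero hn
    rw [word_nil, map_one, series_one, nestedSum, Finset.sum_range_succ']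
    simp [coeff_one]
  | cons a u ih =>
    rw [nestedSum]
    refine Finset.sum_congr rfl fun m _ => ?_
    rw [enc_word_cons, coeff_series_toH_mul hq1]
    rcases eq_or_ne m 0 with rfl | hm
    · rw [I_zero, zero_mul, zero_mul]
    · rw [ih hm]

theorem summable_coeff_series_enc_word {q : ℂ} (hq1 : ‖q‖ < 1) {u : List ALetter}
    (hu : AdmissibleWord u) : Summable fun n => ‖coeff n (series q (enc (word u)))‖ := by
  cases u with
  | nil =>
    refine summable_of_ne_finset_zero (s := {0}) fun n hn => ?_
    rw [Finset.mem_singleton] at hn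
    rw [word_nil, map_one, series_one, coeff_one, if_neg hn, norm_zero]
  | cons a u =>
    refine Summable.of_nonneg_of_le (fun _ => norm_nonneg _) (fun n => ?_)
      (summable_norm_I_mul_nestedSum hq1 hu)
    rw [enc_word_cons, coeff_series_toH_mul hq1]
    rcases eq_or_ne n 0 with rfl | hn
    · simp [I_zero]
    · rw [sum_coeff_series_enc hq1 u hn, norm_mul]
      exact mul_le_mul_of_nonneg_left (norm_nestedSum_le _ _ _) (norm_nonneg _)

theorem summable_coeff_series_enc {q : ℂ} (hq1 : ‖q‖ < 1) {g : FA} (hg : g ∈ admissibleSpan) :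
    Summable fun n => ‖coeff n (series q (enc g))‖ := by
  induction hg using Submodule.span_induction with
  | mem g h =>
    obtain ⟨u, hu, rfl⟩ := h
    exact summable_coeff_series_enc_word hq1 hu
  | zero => simp [summable_zero]
  | add g g' _ _ h h' =>
    refine Summable.of_nonneg_of_le (fun _ => norm_nonneg _) (fun n => ?_) (h.add h')
    rw [map_add, map_add, map_add]
    exact norm_add_le _ _
  | smul c g _ h =>
    refine (h.mul_left ‖evalHbar q c‖).congr fun n => ?_
    rw [map_smul, map_smulₛₗ, PowerSeries.coeff_smul, smul_eq_mul, norm_mul]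

theorem truncZ_eq_sum_coeff {q : ℂ} (hq1 : ‖q‖ < 1) (g : FA) {n : ℕ} (hn : n ≠ 0) :
    truncZ q n g = ∑ m ∈ Finset.range n, coeff m (series q (enc g)) := by
  induction mem_wordSpan_true g using Submodule.span_induction with
  | mem g h =>
    obtain ⟨u, _, rfl⟩ := h
    rw [truncZ_word, sum_coeff_series_enc hq1 u hn]
  | zero => simp
  | add g g' _ _ h h' => simp only [map_add, Finset.sum_add_distrib, h, h']
  | smul c g _ h => simp only [map_smul, map_smulₛₗ, ← Finset.smul_sum, h]

theorem tsum_coeff_series_enc {q : ℂ} (hq1 : ‖q‖ < 1) {g : FA} (hg : g ∈ admissibleSpan) :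
    ∑' n, coeff n (series q (enc g)) = ZFree q g := by
  refine tendsto_nhds_unique
    (summable_coeff_series_enc hq1 hg).of_norm.hasSum.tendsto_sum_nat ?_
  refine (tendsto_truncZ hq1 hg).congr' ?_
  filter_upwards [eventually_ne_atTop 0] with n hn
  exact truncZ_eq_sum_coeff hq1 g hn

/-! ### The words spanning `𝔥¹` and `Ĥ⁰` -/

/-- The span of the words in which each `x` is followed by `x` or `y`, and which start with
`x` or `y`. -/
abbrev goodSpanXY : Submodule Coeff H := wordSpan fun w => StartsXY w ∧ GoodWord w

/-- The span of the words in which each `x` is followed by `x` or `y`; it is `𝔥¹`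
(see `wordSpan_goodWord`). -/
abbrev goodSpan : Submodule Coeff H := wordSpan GoodWord

theorem goodSpanXY_le : goodSpanXY ≤ goodSpan :=
  Submodule.span_mono fun _ ⟨u, hu, e⟩ => ⟨u, hu.2, e⟩

theorem one_mem_goodSpan : (1 : H) ∈ goodSpan := by
  rw [← word_nil]
  exact word_mem_wordSpan (p := GoodWord) trivial

theorem rho_mul_mem_goodSpan {g : H} (hg : g ∈ goodSpan) : rho * g ∈ goodSpan := by
  refine mul_mem_of_word (fun u hu => ?_) hg
  rw [rho, ← word_cons]
  exact word_mem_wordSpan (p := GoodWord) hu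

theorem y_mul_mem_goodSpanXY {g : H} (hg : g ∈ goodSpan) : y * g ∈ goodSpanXY := by
  refine mul_mem_of_word (fun u hu => ?_) hg
  rw [y, ← word_cons]
  exact word_mem_wordSpan (p := fun w => StartsXY w ∧ GoodWord w) ⟨trivial, hu⟩

theorem x_mul_mem_goodSpanXY {g : H} (hg : g ∈ goodSpanXY) : x * g ∈ goodSpanXY := by
  refine mul_mem_of_word (fun u hu => ?_) hg
  rw [x, ← word_cons]
  exact word_mem_wordSpan (p := fun w => StartsXY w ∧ GoodWord w) ⟨trivial, hu⟩

theorem x_pow_mul_mem_goodSpanXY {g : H} (hg : g ∈ goodSpanXY) (k : ℕ) :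
    x ^ k * g ∈ goodSpanXY := by
  induction k with
  | zero => rwa [pow_zero, one_mul]
  | succ k ih => rw [pow_succ', mul_assoc]; exact x_mul_mem_goodSpanXY ih

theorem toH_mul_mem_goodSpan (a : ALetter) {g : H} (hg : g ∈ goodSpan) : a.toH * g ∈ goodSpan := by
  cases a with
  | xi =>
    rw [ALetter.toH, QMZV.xi, sub_mul]
    exact Submodule.sub_mem _ (goodSpanXY_le (y_mul_mem_goodSpanXY hg)) (rho_mul_mem_goodSpan hg)
  | z k hk =>
    rw [ALetter.toH, QMZV.z, mul_assoc]
    exact goodSpanXY_le (x_pow_mul_mem_goodSpanXY (y_mul_mem_goodSpanXY hg) _)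

theorem enc_mem_goodSpan (g : FA) : enc g ∈ goodSpan := by
  have : wordSpan (fun _ : List ALetter => True) ≤ goodSpan.comap enc.toLinearMap := by
    refine Submodule.span_le.2 ?_
    rintro _ ⟨u, -, rfl⟩
    change enc (word u) ∈ goodSpan
    induction u with
    | nil => rw [word_nil, map_one]; exact one_mem_goodSpan
    | cons a u ih => rw [enc_word_cons]; exact toH_mul_mem_goodSpan a ih
  exact this (mem_wordSpan_true g)

theorem y_mem_H1 : y ∈ H1 := by
  have := toH_mem_H1 (ALetter.z 1 le_rfl)
  simpa [ALetter.toH, QMZV.z] using this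

theorem rho_mem_H1 : rho ∈ H1 := by
  have := H1.sub_mem y_mem_H1 (toH_mem_H1 ALetter.xi)
  simpa [ALetter.toH, QMZV.xi] using this

theorem x_pow_mul_word_mem_H1 {w : List Letter} (hw : GoodWord w) (k : ℕ)
    (hk : k ≠ 0 → StartsXY w) : x ^ k * word w ∈ H1 := by
  induction w generalizing k with
  | nil =>
    obtain rfl : k = 0 := by
      by_contra h
      exact hk h
    rw [pow_zero, one_mul, word_nil]
    exact H1.one_mem
  | cons a w ih =>
    cases a with
    | x =>
      rw [word_cons, ← mul_assoc]
      change x ^ k * x * word w ∈ H1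
      rw [← pow_succ]
      exact ih hw.2 _ fun _ => hw.1
    | y =>
      rw [word_cons, ← mul_assoc]
      have h := ih hw 0 (fun h => absurd rfl h)
      rw [pow_zero, one_mul] at h
      exact H1.mul_mem (toH_mem_H1 (ALetter.z (k + 1) (Nat.le_add_left 1 k))) h
    | rho =>
      obtain rfl : k = 0 := by
        by_contra h
        exact hk h
      have h := ih hw 0 (fun h => absurd rfl h)
      rw [pow_zero, one_mul] at h ⊢
      rw [word_cons]
      exact H1.mul_mem rho_mem_H1 h

theorem wordSpan_goodWord : goodSpan = Subalgebra.toSubmodule H1 := by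
  apply le_antisymm
  · refine Submodule.span_le.2 ?_
    rintro _ ⟨w, hw, rfl⟩
    have := x_pow_mul_word_mem_H1 hw 0 (fun h => absurd rfl h)
    rwa [pow_zero, one_mul] at this
  · intro h hh
    have : h ∈ H1 := hh
    rw [← enc_range] at this
    obtain ⟨g, rfl⟩ := this
    exact enc_mem_goodSpan g

theorem xi_mul_mem_H0hat {g : H} (hg : g ∈ goodSpan) : xi * g ∈ H0hat := by
  rw [wordSpan_goodWord] at hg
  exact Submodule.mem_sup_left (Submodule.mem_sup_right ⟨g, hg, rfl⟩)

theorem z_mul_mem_H0hat {k : ℕ} (hk : 2 ≤ k) {g : H} (hg : g ∈ goodSpan) : z k * g ∈ H0hat := by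
  rw [wordSpan_goodWord] at hg
  exact Submodule.mem_sup_right
    (Submodule.mem_iSup_of_mem k (Submodule.mem_iSup_of_mem hk ⟨g, hg, rfl⟩))

theorem one_mem_H0hat : (1 : H) ∈ H0hat :=
  Submodule.mem_sup_left (Submodule.mem_sup_left (Submodule.subset_span rfl))

theorem x_pow_succ_mul_word_mem_H0hat {w : List Letter} (hw : GoodWord w) (hs : StartsXY w)
    (k : ℕ) : x ^ (k + 1) * word w ∈ H0hat := by
  induction w generalizing k with
  | nil => exact hs.elim
  | cons a w ih =>
    cases a with
    | x =>
      rw [word_cons, ← mul_assoc]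
      change x ^ (k + 1) * x * word w ∈ H0hat
      rw [← pow_succ]
      exact ih hw.2 hw.1 _
    | y =>
      rw [word_cons, ← mul_assoc]
      exact z_mul_mem_H0hat (k := k + 2) (by omega) (word_mem_wordSpan (p := GoodWord) hw)
    | rho => exact hs.elim

theorem x_mul_mem_H0hat {g : H} (hg : g ∈ goodSpanXY) : x * g ∈ H0hat := by
  refine mul_mem_of_word (fun u hu => ?_) hg
  simpa using x_pow_succ_mul_word_mem_H0hat hu.2 hu.1 0

/-- `Ĥ⁰` is spanned by `1`, `ξ g` for `g` in `𝔥¹`, and `x g` for `g` in the span of the words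
in `𝔥¹` starting with `x` or `y`. -/
theorem H0hat_le_span : H0hat ≤ Submodule.span Coeff
    {h | h = 1 ∨ (∃ g ∈ goodSpan, h = xi * g) ∨ ∃ g ∈ goodSpanXY, h = x * g} := by
  refine sup_le (sup_le ?_ ?_) (iSup₂_le fun k hk => ?_)
  · exact Submodule.span_mono fun h hh => Or.inl hh
  · rintro _ ⟨g, hg, rfl⟩
    rw [← wordSpan_goodWord] at hg
    exact Submodule.subset_span (Or.inr (Or.inl ⟨g, hg, rfl⟩))
  · rintro _ ⟨g, hg, rfl⟩
    rw [← wordSpan_goodWord] at hg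
    obtain ⟨j, rfl⟩ := Nat.exists_eq_add_of_le' hk
    refine Submodule.subset_span (Or.inr (Or.inr ⟨x ^ j * (y * g),
      x_pow_mul_mem_goodSpanXY (y_mul_mem_goodSpanXY hg) j, ?_⟩))
    rw [LinearMap.mulLeft_apply, QMZV.z, show j + 2 - 1 = j + 1 by omega, pow_succ', mul_assoc,
      mul_assoc]

/-! ### Closure of `Ĥ⁰` under the integral shuffle product -/

/-- Two elements of `𝔥` that depend bilinearly on `g` and `h` agree if they agree on words. -/
theorem bilin_ext {B B' : H →ₗ[Coeff] H →ₗ[Coeff] H}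
    (hB : ∀ u v, B (word u) (word v) = B' (word u) (word v)) : B = B' := by
  refine (wordBasis Letter).ext fun u => (wordBasis Letter).ext fun v => ?_
  rw [wordBasis_apply, wordBasis_apply, hB]

theorem sh_ι_mul (a b : Letter) (g h : H) :
    sh (FreeAlgebra.ι Coeff a * g) (FreeAlgebra.ι Coeff b * h) =
      FreeAlgebra.ι Coeff a * sh g (FreeAlgebra.ι Coeff b * h) +
        FreeAlgebra.ι Coeff b * sh (FreeAlgebra.ι Coeff a * g) h + alpha a b * sh g h := by
  let S := bilinExtend shWord
  let L : H → H →ₗ[Coeff] H := LinearMap.mulLeft Coeff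
  have : S.compl₁₂ (L (FreeAlgebra.ι Coeff a)) (L (FreeAlgebra.ι Coeff b)) =
      (S.compl₁₂ LinearMap.id (L (FreeAlgebra.ι Coeff b))).compr₂ (L (FreeAlgebra.ι Coeff a)) +
      (S.compl₁₂ (L (FreeAlgebra.ι Coeff a)) LinearMap.id).compr₂ (L (FreeAlgebra.ι Coeff b)) +
      S.compr₂ (L (alpha a b)) := by
    refine bilin_ext fun u v => ?_
    simp only [LinearMap.compl₁₂_apply, LinearMap.compr₂_apply, LinearMap.add_apply,
      LinearMap.id_apply, L, LinearMap.mulLeft_apply, S, ← word_cons, bilinExtend_word,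
      shWord_cons]
  exact LinearMap.congr_fun₂ this g h

theorem alpha_rho_right (a : Letter) : alpha a Letter.rho = -(FreeAlgebra.ι Coeff a * rho) := by
  cases a <;> rfl

theorem alpha_rho_left (a : Letter) : alpha Letter.rho a = -(FreeAlgebra.ι Coeff a * rho) := by
  cases a <;> rfl

/-- A leading `ρ` in either factor can be moved out of an integral shuffle product. -/
theorem shWord_rho_right (u v : List Letter) :
    shWord u (Letter.rho :: v) = rho * shWord u v := by
  induction u with
  | nil => rw [shWord_nil_left, shWord_nil_left, word_cons, rho]
  | cons a u ih =>
    rw [shWord_cons, ih, alpha_rho_right, neg_mul_rho_mul, add_right_comm]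
    simp [rho]

theorem shWord_rho_left (u v : List Letter) :
    shWord (Letter.rho :: u) v = rho * shWord u v := by
  induction v with
  | nil => rw [shWord_nil_right, shWord_nil_right, word_cons, rho]
  | cons b v ih =>
    rw [shWord_cons, ih, alpha_rho_left, neg_mul_rho_mul, add_assoc]
    simp [rho]

theorem sh_rho_mul_left (g h : H) : sh (rho * g) h = rho * sh g h := by
  have : (bilinExtend shWord).compl₁₂ (LinearMap.mulLeft Coeff rho) LinearMap.id =
      (bilinExtend shWord).compr₂ (LinearMap.mulLeft Coeff rho) := by
    refine bilin_ext fun u v => ?_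
    simp only [LinearMap.compl₁₂_apply, LinearMap.compr₂_apply, LinearMap.id_apply,
      LinearMap.mulLeft_apply, bilinExtend_word, ← shWord_rho_left]
    rw [rho, ← word_cons, bilinExtend_word]
  exact LinearMap.congr_fun₂ this g h

theorem sh_rho_mul_right (g h : H) : sh g (rho * h) = rho * sh g h := by
  have : (bilinExtend shWord).compl₁₂ LinearMap.id (LinearMap.mulLeft Coeff rho) =
      (bilinExtend shWord).compr₂ (LinearMap.mulLeft Coeff rho) := by
    refine bilin_ext fun u v => ?_
    simp only [LinearMap.compl₁₂_apply, LinearMap.compr₂_apply, LinearMap.id_apply,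
      LinearMap.mulLeft_apply, bilinExtend_word, ← shWord_rho_right]
    rw [rho, ← word_cons, bilinExtend_word]
  exact LinearMap.congr_fun₂ this g h

theorem sh_one_left (h : H) : sh 1 h = h := by
  have : bilinExtend shWord 1 = LinearMap.id := by
    refine (wordBasis Letter).ext fun v => ?_
    rw [wordBasis_apply, ← word_nil, bilinExtend_word, shWord_nil_left, LinearMap.id_apply]
  exact LinearMap.congr_fun this h

theorem sh_one_right (h : H) : sh h 1 = h := by
  have : (bilinExtend shWord).flip 1 = LinearMap.id := by
    refine (wordBasis Letter).ext fun v => ?_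
    rw [wordBasis_apply, LinearMap.flip_apply, ← word_nil, bilinExtend_word, shWord_nil_right,
      LinearMap.id_apply]
  exact LinearMap.congr_fun this h

/-- The two parts need each other: in front of a prefixed `x`, a product has to consist of words
starting with `x` or `y`. -/
theorem shWord_mem : ∀ {u v : List Letter}, GoodWord u → GoodWord v →
    shWord u v ∈ goodSpan ∧ (StartsXY u → StartsXY v → shWord u v ∈ goodSpanXY)
  | [], v, _, hv => by
    rw [shWord_nil_left]
    exact ⟨word_mem_wordSpan hv, fun h => h.elim⟩
  | a :: u, [], hu, _ => by
    rw [shWord_nil_right]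
    exact ⟨word_mem_wordSpan hu, fun _ h => h.elim⟩
  | Letter.rho :: u, b :: v, hu, hv => by
    rw [shWord_rho_left]
    exact ⟨rho_mul_mem_goodSpan (shWord_mem hu.tail hv).1, fun h => h.elim⟩
  | a :: u, Letter.rho :: v, hu, hv => by
    rw [shWord_rho_right]
    exact ⟨rho_mul_mem_goodSpan (shWord_mem hu hv.tail).1, fun _ h => h.elim⟩
  | Letter.x :: u, Letter.x :: v, hu, hv => by
    suffices h : shWord (Letter.x :: u) (Letter.x :: v) ∈ goodSpanXY from
      ⟨goodSpanXY_le h, fun _ _ => h⟩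
    rw [shWord_cons, alpha, smul_mul_assoc]
    exact add_mem (add_mem (x_mul_mem_goodSpanXY ((shWord_mem hu.tail hv).2 hu.1 trivial))
      (x_mul_mem_goodSpanXY ((shWord_mem hu hv.tail).2 trivial hv.1)))
      (Submodule.smul_mem _ _ (x_mul_mem_goodSpanXY ((shWord_mem hu.tail hv.tail).2 hu.1 hv.1)))
  | Letter.x :: u, Letter.y :: v, hu, hv => by
    suffices h : shWord (Letter.x :: u) (Letter.y :: v) ∈ goodSpanXY from
      ⟨goodSpanXY_le h, fun _ _ => h⟩
    rw [shWord_cons, alpha, zero_mul, add_zero]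
    exact add_mem (x_mul_mem_goodSpanXY ((shWord_mem hu.tail hv).2 hu.1 trivial))
      (y_mul_mem_goodSpanXY (shWord_mem hu hv.tail).1)
  | Letter.y :: u, Letter.x :: v, hu, hv => by
    suffices h : shWord (Letter.y :: u) (Letter.x :: v) ∈ goodSpanXY from
      ⟨goodSpanXY_le h, fun _ _ => h⟩
    rw [shWord_cons, alpha, zero_mul, add_zero]
    exact add_mem (y_mul_mem_goodSpanXY (shWord_mem hu.tail hv).1)
      (x_mul_mem_goodSpanXY ((shWord_mem hu hv.tail).2 trivial hv.1))
  | Letter.y :: u, Letter.y :: v, hu, hv => by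
    suffices h : shWord (Letter.y :: u) (Letter.y :: v) ∈ goodSpanXY from
      ⟨goodSpanXY_le h, fun _ _ => h⟩
    rw [shWord_cons, alpha, y, neg_mul_rho_mul]
    exact add_mem (add_mem (y_mul_mem_goodSpanXY (shWord_mem hu.tail hv).1)
      (y_mul_mem_goodSpanXY (shWord_mem hu hv.tail).1))
      (neg_mem (y_mul_mem_goodSpanXY (rho_mul_mem_goodSpan (shWord_mem hu.tail hv.tail).1)))
  termination_by u v => u.length + v.length

theorem sh_mem_goodSpan {g h : H} (hg : g ∈ goodSpan) (hh : h ∈ goodSpan) :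
    sh g h ∈ goodSpan :=
  bilinExtend_mem (fun _ _ hu hv => (shWord_mem hu hv).1) hg hh

theorem sh_mem_goodSpanXY {g h : H} (hg : g ∈ goodSpanXY) (hh : h ∈ goodSpanXY) :
    sh g h ∈ goodSpanXY :=
  bilinExtend_mem (fun _ _ hu hv => (shWord_mem hu.2 hv.2).2 hu.1 hv.1) hg hh

theorem sh_sub_left (g g' h : H) : sh (g - g') h = sh g h - sh g' h := by
  rw [sh, map_sub, LinearMap.sub_apply, sh, sh]

theorem sh_sub_right (g h h' : H) : sh g (h - h') = sh g h - sh g h' := map_sub _ _ _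

theorem sh_y_mul_y_mul (g h : H) :
    sh (y * g) (y * h) = y * sh g (y * h) + y * sh (y * g) h - y * (rho * sh g h) := by
  rw [sub_eq_add_neg, y, ← neg_mul_rho_mul]
  exact sh_ι_mul Letter.y Letter.y g h

theorem sh_x_mul_y_mul (g h : H) :
    sh (x * g) (y * h) = x * sh g (y * h) + y * sh (x * g) h := by
  have := sh_ι_mul Letter.x Letter.y g h
  rwa [alpha, zero_mul, add_zero] at this

theorem sh_y_mul_x_mul (g h : H) :
    sh (y * g) (x * h) = y * sh g (x * h) + x * sh (y * g) h := by
  have := sh_ι_mul Letter.y Letter.x g h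
  rwa [alpha, zero_mul, add_zero] at this

theorem sh_x_mul_x_mul (g h : H) : sh (x * g) (x * h) =
    x * sh g (x * h) + x * sh (x * g) h + hbar • (x * sh g h) := by
  rw [← smul_mul_assoc]
  exact sh_ι_mul Letter.x Letter.x g h

/-- The correction `-y ρ` of the letters `y, y` combines with the terms from moving out `ρ`, so that
every term again starts with `ξ = y - ρ`. -/
theorem sh_xi_mul_xi_mul (g h : H) : sh (xi * g) (xi * h) =
    xi * sh g (y * h) + xi * sh (y * g) h - xi * (rho * sh g h) := by
  simp only [xi, sub_mul, sh_sub_left, sh_sub_right, sh_rho_mul_left, sh_rho_mul_right,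
    sh_y_mul_y_mul, mul_sub]
  abel

theorem sh_xi_mul_x_mul (g h : H) :
    sh (xi * g) (x * h) = xi * sh g (x * h) + x * sh (y * g) h := by
  simp only [xi, sub_mul, sh_sub_left, sh_rho_mul_left, sh_y_mul_x_mul]
  abel

theorem sh_x_mul_xi_mul (g h : H) :
    sh (x * g) (xi * h) = x * sh g (y * h) + xi * sh (x * g) h := by
  simp only [xi, sub_mul, sh_sub_right, sh_rho_mul_right, sh_x_mul_y_mul]
  abel

theorem sh_mem_H0hat {g h : H} (hg : g ∈ H0hat) (hh : h ∈ H0hat) : sh g h ∈ H0hat := by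
  refine LinearMap.BilinMap.apply_apply_mem_of_mem_span H0hat _ _ (bilinExtend shWord) ?_ g h
    (H0hat_le_span hg) (H0hat_le_span hh)
  intro g hg h hh
  change sh g h ∈ H0hat
  rcases hg with rfl | ⟨a, ha, rfl⟩ | ⟨a, ha, rfl⟩ <;>
    rcases hh with rfl | ⟨b, hb, rfl⟩ | ⟨b, hb, rfl⟩
  · rw [sh_one_left]; exact one_mem_H0hat
  · rw [sh_one_left]; exact xi_mul_mem_H0hat hb
  · rw [sh_one_left]; exact x_mul_mem_H0hat hb
  · rw [sh_one_right]; exact xi_mul_mem_H0hat ha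
  · rw [sh_xi_mul_xi_mul]
    exact sub_mem (add_mem
      (xi_mul_mem_H0hat (sh_mem_goodSpan ha (goodSpanXY_le (y_mul_mem_goodSpanXY hb))))
      (xi_mul_mem_H0hat (sh_mem_goodSpan (goodSpanXY_le (y_mul_mem_goodSpanXY ha)) hb)))
      (xi_mul_mem_H0hat (rho_mul_mem_goodSpan (sh_mem_goodSpan ha hb)))
  · rw [sh_xi_mul_x_mul]
    exact add_mem
      (xi_mul_mem_H0hat (sh_mem_goodSpan ha (goodSpanXY_le (x_mul_mem_goodSpanXY hb))))
      (x_mul_mem_H0hat (sh_mem_goodSpanXY (y_mul_mem_goodSpanXY ha) hb))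
  · rw [sh_one_right]; exact x_mul_mem_H0hat ha
  · rw [sh_x_mul_xi_mul]
    exact add_mem
      (x_mul_mem_H0hat (sh_mem_goodSpanXY ha (y_mul_mem_goodSpanXY hb)))
      (xi_mul_mem_H0hat (sh_mem_goodSpan (goodSpanXY_le (x_mul_mem_goodSpanXY ha)) hb))
  · rw [sh_x_mul_x_mul]
    exact add_mem (add_mem (x_mul_mem_H0hat (sh_mem_goodSpanXY ha (x_mul_mem_goodSpanXY hb)))
      (x_mul_mem_H0hat (sh_mem_goodSpanXY (x_mul_mem_goodSpanXY ha) hb)))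
      (Submodule.smul_mem _ _ (x_mul_mem_H0hat (sh_mem_goodSpanXY ha hb)))

/-- By absolute convergence, the coefficients of a product of series (a Cauchy product) sum to the
product of the two sums; no limit `t → 1` is involved. -/
theorem ZFree_sh {q : ℂ} (hq1 : ‖q‖ < 1) {f g g' : FA} (hf : f ∈ admissibleSpan)
    (hg : g ∈ admissibleSpan) (hg' : g' ∈ admissibleSpan) (h : enc f = sh (enc g) (enc g')) :
    ZFree q f = ZFree q g * ZFree q g' := by
  rw [← tsum_coeff_series_enc hq1 hf, ← tsum_coeff_series_enc hq1 hg,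
    ← tsum_coeff_series_enc hq1 hg', tsum_mul_tsum_eq_tsum_sum_antidiagonal_of_summable_norm
      (summable_coeff_series_enc hq1 hg) (summable_coeff_series_enc hq1 hg')]
  refine tsum_congr fun n => ?_
  have hm : series q (sh (enc g) (enc g')) = series q (enc g) * series q (enc g') := by
    refine map_bilinExtend (series q) (p := GoodWord)
      (fun u v hu hv => series_shWord hq1 hu hv) (enc_mem_goodSpan g) (enc_mem_goodSpan g')
  rw [h, hm, coeff_mul]

/-! ### Homogeneity -/

section Weight

variable {X : Type} (wt : X → ℕ)

/-- The homogeneous component of weight `d` of a free algebra over `ℚ[ħ]` in which a letter `a` has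
weight `wt a` and `ħ` has weight one. -/
def gradedPart (d : ℕ) : Submodule ℚ (FreeAlgebra Coeff X) :=
  Submodule.span ℚ {g | ∃ (j : ℕ) (u : List X), j + (u.map wt).sum = d ∧ g = hbar ^ j • word u}

variable {wt}

theorem mem_gradedPart_of_eq {d e : ℕ} (h : d = e) {g : FreeAlgebra Coeff X}
    (hg : g ∈ gradedPart wt d) : g ∈ gradedPart wt e := h ▸ hg

theorem word_mem_gradedPart (u : List X) : word u ∈ gradedPart wt (u.map wt).sum :=
  Submodule.subset_span ⟨0, u, zero_add _, by rw [pow_zero, one_smul]⟩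

theorem one_mem_gradedPart : (1 : FreeAlgebra Coeff X) ∈ gradedPart wt 0 := by
  rw [← word_nil]
  exact word_mem_gradedPart []

theorem smul_mem_gradedPart (j : ℕ) {d : ℕ} {g : FreeAlgebra Coeff X} (hg : g ∈ gradedPart wt d) :
    hbar ^ j • g ∈ gradedPart wt (j + d) := by
  induction hg using Submodule.span_induction with
  | mem g h =>
    obtain ⟨i, u, rfl, rfl⟩ := h
    exact Submodule.subset_span ⟨j + i, u, by omega, by rw [smul_smul, pow_add]⟩
  | zero => rw [smul_zero]; exact zero_mem _
  | add g g' _ _ h h' => rw [smul_add]; exact add_mem h h'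
  | smul c g _ h => rw [smul_comm]; exact Submodule.smul_mem _ _ h

theorem mul_mem_gradedPart {d e : ℕ} {g h : FreeAlgebra Coeff X} (hg : g ∈ gradedPart wt d)
    (hh : h ∈ gradedPart wt e) : g * h ∈ gradedPart wt (d + e) := by
  refine LinearMap.BilinMap.apply_apply_mem_of_mem_span _ _ _ (LinearMap.mul ℚ _) ?_ g h hg hh
  rintro _ ⟨i, u, rfl, rfl⟩ _ ⟨j, v, rfl, rfl⟩
  refine Submodule.subset_span ⟨i + j, u ++ v, ?_, ?_⟩
  · rw [List.map_append, List.sum_append]; omega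
  · rw [LinearMap.mul_apply', smul_mul_smul_comm, ← pow_add]
    simp only [word, List.map_append, List.prod_append]

theorem ι_mem_gradedPart (a : X) : FreeAlgebra.ι Coeff a ∈ gradedPart wt (wt a) := by
  have := word_mem_gradedPart (wt := wt) [a]
  simpa [word] using this

theorem bilinExtend_mem_gradedPart {f : List X → List X → FreeAlgebra Coeff X}
    (hf : ∀ u v, f u v ∈ gradedPart wt ((u.map wt).sum + (v.map wt).sum)) {d e : ℕ}
    {g h : FreeAlgebra Coeff X} (hg : g ∈ gradedPart wt d) (hh : h ∈ gradedPart wt e) :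
    bilinExtend f g h ∈ gradedPart wt (d + e) := by
  induction hg using Submodule.span_induction with
  | mem g hg =>
    obtain ⟨i, u, rfl, rfl⟩ := hg
    induction hh using Submodule.span_induction with
    | mem h hh =>
      obtain ⟨j, v, rfl, rfl⟩ := hh
      rw [map_smul, map_smul, LinearMap.smul_apply, bilinExtend_word, smul_smul, ← pow_add]
      exact mem_gradedPart_of_eq (by omega) (smul_mem_gradedPart (j + i) (hf u v))
    | zero => rw [map_zero]; exact zero_mem _
    | add a b _ _ ha hb => rw [map_add]; exact add_mem ha hb
    | smul c a _ ha => rw [LinearMap.map_smul_of_tower]; exact Submodule.smul_mem _ _ ha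
  | zero => rw [map_zero, LinearMap.zero_apply]; exact zero_mem _
  | add a b _ _ ha hb => rw [map_add, LinearMap.add_apply]; exact add_mem ha hb
  | smul c a _ ha =>
    rw [LinearMap.map_smul_of_tower, LinearMap.smul_apply]
    exact Submodule.smul_mem _ _ ha

end Weight

theorem weightPart_eq (d : ℕ) : weightPart d = gradedPart (fun _ => 1) d := by
  simp [weightPart, gradedPart]

theorem ι_mem_gradedPart_one (c : Letter) :
    FreeAlgebra.ι Coeff c ∈ gradedPart (fun _ : Letter => 1) 1 :=
  ι_mem_gradedPart c

theorem neg_mul_rho_mem_gradedPart (c : Letter) :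
    -(FreeAlgebra.ι Coeff c * rho) ∈ gradedPart (fun _ : Letter => 1) 2 :=
  Submodule.neg_mem _ (mul_mem_gradedPart (d := 1) (e := 1) (ι_mem_gradedPart_one c)
    (ι_mem_gradedPart_one Letter.rho))

theorem hbar_smul_x_mem_gradedPart : hbar • x ∈ gradedPart (fun _ : Letter => 1) 2 := by
  have hx := smul_mem_gradedPart 1 (ι_mem_gradedPart_one Letter.x)
  rw [pow_one] at hx
  exact hx

theorem alpha_mem_gradedPart (a b : Letter) :
    alpha a b ∈ gradedPart (fun _ : Letter => 1) 2 := by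
  cases a with
  | x =>
    cases b with
    | x => exact hbar_smul_x_mem_gradedPart
    | y => exact Submodule.zero_mem _
    | rho => exact neg_mul_rho_mem_gradedPart Letter.x
  | y =>
    cases b with
    | x => exact Submodule.zero_mem _
    | y => exact neg_mul_rho_mem_gradedPart Letter.y
    | rho => exact neg_mul_rho_mem_gradedPart Letter.y
  | rho =>
    rw [alpha_rho_left]
    exact neg_mul_rho_mem_gradedPart b

theorem shWord_mem_gradedPart : ∀ u v : List Letter,
    shWord u v ∈ gradedPart (fun _ => 1) ((u.map fun _ => 1).sum + (v.map fun _ => 1).sum)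
  | [], v => by
    rw [shWord_nil_left, List.map_nil, List.sum_nil, zero_add]
    exact word_mem_gradedPart v
  | a :: u, [] => by
    rw [shWord_nil_right, List.map_nil, List.sum_nil, add_zero]
    exact word_mem_gradedPart (a :: u)
  | a :: u, b :: v => by
    rw [shWord_cons]
    have h1 := mul_mem_gradedPart (ι_mem_gradedPart a) (shWord_mem_gradedPart u (b :: v))
    have h2 := mul_mem_gradedPart (ι_mem_gradedPart b) (shWord_mem_gradedPart (a :: u) v)
    have h3 := mul_mem_gradedPart (alpha_mem_gradedPart a b) (shWord_mem_gradedPart u v)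
    simp only [List.map_cons, List.sum_cons] at h1 h2 h3 ⊢
    refine add_mem (add_mem ?_ ?_) ?_
    · exact mem_gradedPart_of_eq (by omega) h1
    · exact mem_gradedPart_of_eq (by omega) h2
    · exact mem_gradedPart_of_eq (by omega) h3
  termination_by u v => u.length + v.length

theorem circ_mem_gradedPart (a b : ALetter) :
    circ a b ∈ gradedPart ALetter.weight (a.weight + b.weight) := by
  rcases a with _ | ⟨k, hk⟩ <;> rcases b with _ | ⟨l, hl⟩ <;>
    simp only [circ, ALetter.weight]
  · refine sub_mem (ι_mem_gradedPart (ALetter.z 2 _)) ?_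
    have := smul_mem_gradedPart 1 (ι_mem_gradedPart (wt := ALetter.weight) ALetter.xi)
    rwa [pow_one] at this
  · rw [add_comm]
    exact ι_mem_gradedPart (ALetter.z (l + 1) _)
  · exact ι_mem_gradedPart (ALetter.z (k + 1) _)
  · refine add_mem (ι_mem_gradedPart (ALetter.z (k + l) _)) ?_
    have := smul_mem_gradedPart 1
      (ι_mem_gradedPart (wt := ALetter.weight) (ALetter.z (k + l - 1) (by omega)))
    rw [pow_one] at this
    exact mem_gradedPart_of_eq (by simp only [ALetter.weight]; omega) this

theorem harmWord_mem_gradedPart : ∀ u v : List ALetter, harmWord u v ∈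
    gradedPart ALetter.weight ((u.map ALetter.weight).sum + (v.map ALetter.weight).sum)
  | [], v => by
    rw [harmWord_nil_left, List.map_nil, List.sum_nil, zero_add]
    exact word_mem_gradedPart v
  | a :: u, [] => by
    rw [harmWord_nil_right, List.map_nil, List.sum_nil, add_zero]
    exact word_mem_gradedPart (a :: u)
  | a :: u, b :: v => by
    rw [harmWord_cons]
    have h1 := mul_mem_gradedPart (ι_mem_gradedPart a) (harmWord_mem_gradedPart u (b :: v))
    have h2 := mul_mem_gradedPart (ι_mem_gradedPart b) (harmWord_mem_gradedPart (a :: u) v)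
    have h3 := mul_mem_gradedPart (circ_mem_gradedPart a b) (harmWord_mem_gradedPart u v)
    simp only [List.map_cons, List.sum_cons] at h1 h2 h3 ⊢
    refine add_mem (add_mem ?_ ?_) ?_
    · exact mem_gradedPart_of_eq (by omega) h1
    · exact mem_gradedPart_of_eq (by omega) h2
    · exact mem_gradedPart_of_eq (by omega) h3
  termination_by u v => u.length + v.length

theorem toH_mem_gradedPart (a : ALetter) : a.toH ∈ gradedPart (fun _ => 1) a.weight := by
  have h := ι_mem_gradedPart_one
  cases a with
  | xi => exact sub_mem (h Letter.y) (h Letter.rho)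
  | z k hk =>
    obtain ⟨j, rfl⟩ := Nat.exists_eq_add_of_le' hk
    rw [ALetter.toH, QMZV.z, Nat.add_sub_cancel, ALetter.weight]
    refine mul_mem_gradedPart ?_ (h Letter.y)
    induction j with
    | zero => exact one_mem_gradedPart
    | succ j ih => rw [pow_succ]; exact mul_mem_gradedPart (ih (by omega)) (h Letter.x)

theorem enc_mem_weightPart {d : ℕ} {g : FA} (hg : g ∈ gradedPart ALetter.weight d) :
    enc g ∈ weightPart d := by
  rw [weightPart_eq]
  induction hg using Submodule.span_induction with
  | mem g h =>
    obtain ⟨j, u, rfl, rfl⟩ := h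
    rw [map_smul]
    refine smul_mem_gradedPart j ?_
    induction u with
    | nil => rw [word_nil, map_one]; exact one_mem_gradedPart
    | cons a u ih =>
      rw [enc_word_cons]
      exact mul_mem_gradedPart (toH_mem_gradedPart a) ih
  | zero => rw [map_zero]; exact zero_mem _
  | add g g' _ _ h h' => rw [map_add]; exact add_mem h h'
  | smul c g _ h =>
    have : enc (c • g) = c • enc g := LinearMap.map_smul_of_tower enc.toLinearMap c g
    rw [this]
    exact Submodule.smul_mem _ _ h

/-! ### The double shuffle relations -/

theorem exists_enc_eq {w : H} (hw : w ∈ H0hat) : ∃ g ∈ admissibleSpan, enc g = w := by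
  rw [H0hat_eq_span] at hw
  induction hw using Submodule.span_induction with
  | mem w h =>
    obtain ⟨u, hu, rfl⟩ := h
    exact ⟨word u, word_mem_wordSpan hu, enc_word u⟩
  | zero => exact ⟨0, zero_mem _, map_zero _⟩
  | add a b _ _ ha hb =>
    obtain ⟨g, hg, rfl⟩ := ha
    obtain ⟨h, hh, rfl⟩ := hb
    exact ⟨g + h, add_mem hg hh, map_add _ _ _⟩
  | smul c a _ ha =>
    obtain ⟨g, hg, rfl⟩ := ha
    exact ⟨c • g, Submodule.smul_mem _ _ hg, map_smul _ _ _⟩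

theorem enc_mem_H0hat {g : FA} (hg : g ∈ admissibleSpan) : enc g ∈ H0hat := by
  have : admissibleSpan ≤ H0hat.comap enc.toLinearMap := by
    refine Submodule.span_le.2 ?_
    rintro _ ⟨u, hu, rfl⟩
    rw [H0hat_eq_span]
    exact Submodule.subset_span ⟨u, hu, enc_word u⟩
  exact this hg

theorem mem_gradedPart_of_enc_mem {d : ℕ} {g : FA} (h : enc g ∈ weightPart d) :
    g ∈ gradedPart ALetter.weight d := by
  rw [← dec_enc g]
  exact dec_mem h

theorem coe_harm_enc (g g' : FA) (h : enc g ∈ H1) (h' : enc g' ∈ H1) :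
    (harm ⟨enc g, h⟩ ⟨enc g', h'⟩ : H) = enc (bilinExtend harmWord g g') := by
  rw [harm, coe_freeEquivH1, freeEquivH1_symm_apply, freeEquivH1_symm_apply, dec_enc, dec_enc]

theorem Z_enc (q : ℂ) (g : FA) (h : enc g ∈ H0hat) : Z q ⟨enc g, h⟩ = ZFree q g := by
  change ZFree q (toFree ⟨enc g, h⟩) = _
  rw [toFree_apply, dec_enc]

theorem sh_mem_weightPart {m n : ℕ} {w w' : H} (hw : w ∈ weightPart m) (hw' : w' ∈ weightPart n) :
    sh w w' ∈ weightPart (m + n) := by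
  rw [weightPart_eq] at *
  exact bilinExtend_mem_gradedPart shWord_mem_gradedPart hw hw'

theorem S_le_H0hatPart (d : ℕ) : S d ≤ H0hatPart d := by
  refine Submodule.span_le.2 ?_
  rintro _ ⟨m, n, w, w', hw, hw', rfl, rfl⟩
  obtain ⟨g, hg, rfl⟩ := exists_enc_eq hw.1
  obtain ⟨g', hg', rfl⟩ := exists_enc_eq hw'.1
  rw [coe_harm_enc]
  refine ⟨sub_mem (enc_mem_H0hat
    (bilinExtend_mem (fun _ _ => harmWord_mem_admissibleSpan) hg hg'))
    (sh_mem_H0hat (enc_mem_H0hat hg) (enc_mem_H0hat hg')),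
    Submodule.sub_mem _ (enc_mem_weightPart ?_) (sh_mem_weightPart hw.2 hw'.2)⟩
  exact bilinExtend_mem_gradedPart harmWord_mem_gradedPart (mem_gradedPart_of_enc_mem hw.2)
    (mem_gradedPart_of_enc_mem hw'.2)

theorem S_le_kerZbar {q : ℂ} (hq1 : ‖q‖ < 1) (d : ℕ) : S d ≤ kerZbar q := by
  refine Submodule.span_le.2 fun s hs => ?_
  have hsd : s ∈ H0hatPart d := S_le_H0hatPart d (Submodule.subset_span hs)
  refine ⟨⟨s, hsd.1⟩, ?_, rfl⟩
  change Zbar q ⟨s, hsd.1⟩ = 0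
  rw [Zbar_eq q d _ hsd]
  obtain ⟨m, n, w, w', hw, hw', rfl, rfl⟩ := hs
  obtain ⟨g, hg, rfl⟩ := exists_enc_eq hw.1
  obtain ⟨g', hg', rfl⟩ := exists_enc_eq hw'.1
  obtain ⟨f, hf, hfe⟩ := exists_enc_eq (sh_mem_H0hat (enc_mem_H0hat hg) (enc_mem_H0hat hg'))
  have hb := bilinExtend_mem (fun _ _ => harmWord_mem_admissibleSpan) hg hg'
  have hbf : bilinExtend harmWord g g' - f ∈ admissibleSpan := sub_mem hb hf
  have e : (⟨_, hsd.1⟩ : H0hat) = ⟨enc (bilinExtend harmWord g g' - f), enc_mem_H0hat hbf⟩ := by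
    apply Subtype.ext
    simp only [coe_harm_enc, map_sub, hfe]
  rw [e, Z_enc, map_sub, ZFree_harm hq1 hg hg', ZFree_sh hq1 hf hg hg' hfe, sub_self, mul_zero]

/-- The word in the alphabet `A` belonging to an index. -/
def indexWord (k : AdmissibleIndex) : List ALetter :=
  k.1.attach.map fun a => ALetter.z a.1 (k.2.1 a.1 a.2)

theorem indexWord_map {Y : Type} (k : AdmissibleIndex) (φ : ALetter → Y) (ψ : ℕ → Y)
    (h : ∀ a ha, φ (ALetter.z a ha) = ψ a) : (indexWord k).map φ = k.1.map ψ := by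
  rw [indexWord, List.map_map]
  conv_rhs => rw [← List.attach_map_subtype_val k.1, List.map_map]
  exact List.map_congr_left fun a _ => h _ _

theorem enc_indexWord (k : AdmissibleIndex) : enc (word (indexWord k)) = k.zWord := by
  rw [enc_word, AdmissibleIndex.zWord, indexWord_map k ALetter.toH z fun _ _ => rfl]

theorem wordWeight_indexWord (k : AdmissibleIndex) : wordWeight (indexWord k) = k.weight := by
  rw [wordWeight, AdmissibleIndex.weight, indexWord_map k ALetter.weight id fun _ _ => rfl,
    List.map_id]

theorem admissibleWord_indexWord (k : AdmissibleIndex) : AdmissibleWord (indexWord k) := by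
  obtain ⟨k, h1, h2⟩ := k
  cases k with
  | nil => trivial
  | cons a k => exact h2 a rfl

theorem nestedSum_indexWord {K : Type} [CommSemiring K] (k : AdmissibleIndex)
    (g : ALetter → ℕ → K) (g' : ℕ → ℕ → K) (h : ∀ a ha, g (ALetter.z a ha) = g' a) (N : ℕ) :
    nestedSum g (indexWord k) N = nestedSum g' k.1 N := by
  have e := nestedSum_map (fun (f : ℕ → K) n => f n) g (indexWord k) N
  have e' := nestedSum_map (fun (f : ℕ → K) n => f n) g' k.1 N
  rw [indexWord_map k g g' h] at e
  exact e.symm.trans e'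

theorem ZWord_indexWord {q : ℂ} (hq1 : ‖q‖ < 1) (k : AdmissibleIndex) :
    ZWord q (indexWord k) = zetaq q k := by
  -- The exponent `0` does not occur in an index; it is given the value zero so that `g a 0 = 0`
  -- for all `a`.
  let g : ℕ → ℕ → ℂ := fun a n => if a = 0 then 0 else q ^ ((a - 1) * n) / qInt q n ^ a
  have g0 : ∀ a, g a 0 = 0 := fun a => by
    by_cases h : a = 0 <;> simp [g, h, qInt]
  have hg : ∀ a ha, I q (ALetter.z a ha) = g a := fun a ha => by
    have : a ≠ 0 := by omega
    funext n
    simp [g, this, I]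
  have hb : ∃ c, ∀ N, nestedSum (fun a n => ‖g a n‖) k.1 N ≤ c := by
    obtain ⟨c, hc⟩ := nestedSum_norm_bounded hq1 (admissibleWord_indexWord k)
    refine ⟨c, fun N => le_trans (le_of_eq ?_) (hc N)⟩
    refine (nestedSum_indexWord k _ _ (fun a ha => ?_) N).symm
    rw [hg]
  have h1 := tendsto_nestedSum g k.1 g0 hb
  have h2 := tendsto_nestedSum_ZWord hq1 (admissibleWord_indexWord k)
  have e : nestedSum (I q) (indexWord k) = nestedSum g k.1 :=
    funext fun N => nestedSum_indexWord k _ _ hg N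
  rw [e] at h2
  rw [tendsto_nhds_unique h2 h1, zetaq]
  refine tsum_congr fun n => Finset.prod_congr rfl fun i _ => ?_
  have : k.1.get i ≠ 0 := by
    have := k.2.1 _ (List.get_mem k.1 i)
    omega
  simp only [g, if_neg this]

theorem Zbar_hbar_zWord {q : ℂ} (hq1 : ‖q‖ < 1) (k : AdmissibleIndex) (j : ℕ)
    (h : hbar ^ j • k.zWord ∈ H0hat) : Zbar q ⟨hbar ^ j • k.zWord, h⟩ = zetaqBar q k := by
  change ZbarFree q (toFree _) = _
  have e : toFree ⟨hbar ^ j • k.zWord, h⟩ = hbar ^ j • word (indexWord k) := by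
    rw [toFree_apply]
    simp only
    rw [map_smul, ← enc_indexWord, dec_enc]
  rw [e, ZbarFree_hbar_word, ZFree_smul_word, ZWord_indexWord hq1, wordWeight_indexWord, zetaqBar,
    map_pow, evalHbar_hbar, pow_add, mul_inv]
  have := pow_ne_zero j (one_sub_ne_zero_of_norm_lt_one hq1)
  field_simp

theorem hbar_zWord_mem_H0hat (k : AdmissibleIndex) (j : ℕ) : hbar ^ j • k.zWord ∈ H0hat := by
  rw [← enc_indexWord]
  exact Submodule.smul_mem _ _
    (enc_mem_H0hat (word_mem_wordSpan (p := AdmissibleWord) (admissibleWord_indexWord k)))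

theorem sum_zetaqBar_eq_zero {q : ℂ} (hq1 : ‖q‖ < 1) {d : ℕ} (c : AdmissibleIndex →₀ ℚ)
    (h : (c.sum fun k a => a • (hbar ^ (d - k.weight) • k.zWord)) ∈ S d) :
    (c.sum fun k a => (a : ℂ) * zetaqBar q k) = 0 := by
  obtain ⟨w, hw, e⟩ := S_le_kerZbar hq1 d h
  have hw0 : w = c.sum fun k a =>
      a • (⟨hbar ^ (d - k.weight) • k.zWord, hbar_zWord_mem_H0hat k _⟩ : H0hat) := by
    apply Subtype.ext
    change (w : H) = H0hat.subtype.restrictScalars ℚ _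
    rw [Finsupp.sum, map_sum]
    exact e
  have hz : Zbar q w = 0 := hw
  rw [hw0, Finsupp.sum, map_sum] at hz
  rw [Finsupp.sum, ← hz]
  refine Finset.sum_congr rfl fun k _ => ?_
  rw [map_smul, Zbar_hbar_zWord hq1, Rat.smul_def]

end

end QMZV

theorem mainTheorem3 (q : ℂ) (hq0 : 0 < ‖q‖) (hq1 : ‖q‖ < 1) :
    -- the series defining `Z_q` on the words of `Ĥ⁰` converge absolutely
    (∀ u : List QMZV.ALetter, QMZV.AdmissibleWord u →
      Summable fun n : QMZV.DecSeq u.length => ‖QMZV.ZTerm q u n‖) ∧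
    ∀ d : ℕ,
      -- `S_d` is a subspace of `Ĥ⁰_d` contained in the kernel of `Z̄_q`
      QMZV.S d ≤ QMZV.H0hatPart d ∧
      QMZV.S d ≤ QMZV.kerZbar q ∧
      -- the resulting linear relations among the modified `q`-multiple zeta values
      ∀ c : QMZV.AdmissibleIndex →₀ ℚ, (∀ k ∈ c.support, k.weight ≤ d) →
        (c.sum fun k a => a • (QMZV.hbar ^ (d - k.weight) • k.zWord)) ∈ QMZV.S d →
        (c.sum fun k a => (a : ℂ) * QMZV.zetaqBar q k) = 0 :=
  ⟨fun u hu => QMZV.summable_decSeq (QMZV.I q) u (QMZV.I_zero q)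
      (QMZV.nestedSum_norm_bounded hq1 hu),
    fun d => ⟨QMZV.S_le_H0hatPart d, QMZV.S_le_kerZbar hq1 d,
      fun c _ h => QMZV.sum_zetaqBar_eq_zero hq1 c h⟩⟩
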